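/- Let $\langle x,y\rangle=\sum_j x_jy_j$ and $\|x\|=\langle x,x\rangle^{1/2}$ on $\mathbb{R}^N$, let $z^2=\sum_j z_j^2$ for $z\in\mathbb{C}^N$, and let $\sigma_\alpha(x)=x-\frac{2\langle\alpha,x\rangle}{\|\alpha\|^2}\alpha$ for $0\neq\alpha\in\mathbb{R}^N$. Let $\mathcal{R}\subset\mathbb{R}^N\setminus\{0\}$ be a root system: a finite set, normalized by $\|\alpha\|^2=2$ for all $\alpha\in\mathcal{R}$, such that $-\mathcal{R}=\mathcal{R}$, such that $\alpha,r\alpha\in\mathcal{R}$ with $r\in\mathbb{R}$ implies $r=\pm1$, and such that $\sigma_\alpha(\mathcal{R})=\mathcal{R}$ for all $\alpha\in\mathcal{R}$. Let $G$ be the group generated by the reflections $\sigma_\alpha$, $\alpha\in\mathcal{R}$, and let $\mu:\mathcal{R}\to[0,\infty)$ be $G$-invariant. For $f\in C^1(\mathbb{R}^N)$ and $\xi\in\mathbb{R}^N$ the Dunkl operator is $$T_{\xi,\mu}f(x)=\partial_\xi f(x)+\frac12\sum_{\alpha\in\mathcal{R}}\mu(\alpha)\,\langle\alpha,\xi\rangle\,\frac{f(x)-f(\sigma_\alpha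 x)}{\langle\alpha,x\rangle},$$ where the quotient is replaced by its limit $\frac{2}{\|\alpha\|^2}\partial_\alpha f(x)$ when $\langle\alpha,x\rangle=0$. The Dunkl kernel $E_\mu:\mathbb{C}^N\times\mathbb{C}^N\to\mathbb{C}$ is the holomorphic function that is real valued on $\mathbb{R}^N\times\mathbb{R}^N$ and satisfies there, for all $x,y,\xi\in\mathbb{R}^N$, $$T^x_{\xi,\mu}E_\mu(x,y)=\langle\xi,y\rangle E_\mu(x,y),\qquad E_\mu(0,y)=1.$$ For $t>0$ the Dunkl heat kernel is $$\rho_{\mu,t}(x,q)=e^{-(\|x\|^2+\|q\|^2)/2t}\,E_\mu\!\left(\frac{x}{t^{1/2}},\frac{q}{t^{1/2}}\right)\qquad(x,q\in\mathbb{R}^N),$$ and $\rho_{\mu,t}$ also denotes its holomorphic continuation to $\mathbb{C}^N\times\mathbb{C}^N$. The kernel of the Version A Segal–Bargmann transform is $$A_{\mu,t}(z,q)=\exp\!\left(-\frac{z^2}{2t}-\frac{\|q\|^2}{4t}\right)E_\mu\!\left(\frac{z}{t^{1/2}},\frac{q}{t^{1/2}}\right)\qquad(z\in\mathbb{C}^N,\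 q\in\mathbb{R}^N).$$ **Theorem (Version A).** Suppose that $\mu\ge0$ and $t>0$. Then the Dunkl kernel $E_\mu$ and the holomorphic continuation of $\rho_{\mu,t}$ exist, $\rho_{\mu,t}(0,q)>0$ for all $q\in\mathbb{R}^N$, and $$A_{\mu,t}(z,q)=\frac{\rho_{\mu,t}(z,q)}{\left(\rho_{\mu,t}(0,q)\right)^{1/2}}$$ for all $z\in\mathbb{C}^N$ and $q\in\mathbb{R}^N$, with the positive square root in the denominator. -/

import Mathlib

noncomputable section

namespace Dunkl

/-- The configuration space `ℝ^N` with its Euclidean inner product. -/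
abbrev RealSpace (N : ℕ) : Type := EuclideanSpace ℝ (Fin N)

/-- The phase space `ℂ^N`. -/
abbrev ComplexSpace (N : ℕ) : Type := EuclideanSpace ℂ (Fin N)

/-- The inclusion of `ℝ^N` in `ℂ^N`. -/
def toComplex {N : ℕ} (x : RealSpace N) : ComplexSpace N :=
  WithLp.toLp 2 (fun j => (x j : ℂ))

/-- The holomorphic (not Hermitian) square `z ^ 2 = ∑ j, z_j ^ 2` on `ℂ^N`. -/
def bilinSq {N : ℕ} (z : ComplexSpace N) : ℂ := ∑ j, z j ^ 2

/-- The orthogonal reflection `σ_α` in the hyperplane orthogonal to `α`. -/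
def rootReflection {N : ℕ} (α : RealSpace N) : RealSpace N ≃ₗᵢ[ℝ] RealSpace N :=
  (Submodule.span ℝ {α})ᗮ.reflection

theorem rootReflection_apply {N : ℕ} (α x : RealSpace N) :
    rootReflection α x = x - (2 * inner ℝ α x / ‖α‖ ^ 2) • α := by
  rw [rootReflection, Submodule.reflection_orthogonal_apply, Submodule.reflection_singleton_apply]
  simp only [RCLike.ofReal_real_eq_id, id_eq, neg_sub, mul_div_assoc, mul_smul]
  rw [two_smul, two_smul]

/-- A (reduced) root system in `ℝ^N`, normalized so that every root has squared norm `2`. -/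
structure IsRootSystem {N : ℕ} (R : Finset (RealSpace N)) : Prop where
  ne_zero : ∀ α ∈ R, α ≠ 0
  neg_mem : ∀ α ∈ R, -α ∈ R
  reduced : ∀ α ∈ R, ∀ r : ℝ, r • α ∈ R → r = 1 ∨ r = -1
  reflection_image : ∀ α ∈ R, rootReflection α '' (R : Set (RealSpace N)) = R
  norm_sq : ∀ α ∈ R, ‖α‖ ^ 2 = 2

/-- The finite Coxeter group `G(R)`: the group of isometries generated by the reflections. -/
def coxeterGroup {N : ℕ} (R : Finset (RealSpace N)) :
    Subgroup (RealSpace N ≃ₗᵢ[ℝ] RealSpace N) :=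
  Subgroup.closure {g | ∃ α ∈ R, g = rootReflection α}

/-- A multiplicity function is a function on the roots that is invariant under `G(R)`. -/
def IsMultiplicityFunction {N : ℕ} (R : Finset (RealSpace N)) (μ : R → ℝ) : Prop :=
  ∀ g ∈ coxeterGroup R, ∀ α β : R, (β : RealSpace N) = g α → μ β = μ α

/-- The difference quotient `(f x - f (σ_α x)) / ⟨α, x⟩`. On the hyperplane `⟨α, x⟩ = 0` it stands
for its limit, which for a `C^1` function `f` is `(2 / ‖α‖ ^ 2) ∂_α f x`. -/
def reflectionQuotient {N : ℕ} (α : RealSpace N) (f : RealSpace N → ℂ) (x : RealSpace N) : ℂ :=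
  if inner ℝ α x = 0 then ((2 / ‖α‖ ^ 2 : ℝ) : ℂ) * fderiv ℝ f x α
  else (f x - f (rootReflection α x)) / ((inner ℝ α x : ℝ) : ℂ)

/-- The Dunkl operator `T_{ξ,μ}`, written as half of a sum over all roots, which equals the sum over
the positive roots for any choice of these. -/
def dunklOperator {N : ℕ} {R : Finset (RealSpace N)} (μ : R → ℝ) (ξ : RealSpace N)
    (f : RealSpace N → ℂ) (x : RealSpace N) : ℂ :=
  fderiv ℝ f x ξ +
    (1 / 2) * ∑ α : R, ((μ α * inner ℝ (α : RealSpace N) ξ : ℝ) : ℂ) *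
      reflectionQuotient (α : RealSpace N) f x

/-- Joint holomorphy of a function on `ℂ^N × ℂ^N`. -/
def IsHolomorphic {N : ℕ} (F : ComplexSpace N → ComplexSpace N → ℂ) : Prop :=
  Differentiable ℂ (fun p : ComplexSpace N × ComplexSpace N => F p.1 p.2)

/-- `E` is the holomorphic extension to `ℂ^N × ℂ^N` of a real valued solution on `ℝ^N × ℝ^N` of
`T_ξ E(·, y) = ⟨ξ, y⟩ E(·, y)`, `E(0, y) = 1`. -/
structure IsDunklKernel {N : ℕ} {R : Finset (RealSpace N)} (μ : R → ℝ)
    (E : ComplexSpace N → ComplexSpace N → ℂ) : Prop where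
  holomorphic : IsHolomorphic E
  real_valued : ∀ x y : RealSpace N, (E (toComplex x) (toComplex y)).im = 0
  eigen : ∀ ξ x y : RealSpace N,
    dunklOperator μ ξ (fun u => E (toComplex u) (toComplex y)) x =
      ((inner ℝ ξ y : ℝ) : ℂ) * E (toComplex x) (toComplex y)
  map_zero : ∀ y : RealSpace N, E 0 (toComplex y) = 1

/-- The Dunkl kernel `E_μ` on `ℂ^N × ℂ^N`. -/
def dunklKernel {N : ℕ} {R : Finset (RealSpace N)} (μ : R → ℝ) :
    ComplexSpace N → ComplexSpace N → ℂ :=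
  Classical.epsilon (IsDunklKernel μ)

/-- The Dunkl heat kernel
`ρ_{μ,t}(x, q) = exp (-(x^2 + q^2) / 2t) E_μ(x / t^{1/2}, q / t^{1/2})` on `ℝ^N × ℝ^N`.
The kernel `E_μ` is real on real arguments, so that `re` only changes the type. -/
def heatKernel {N : ℕ} {R : Finset (RealSpace N)} (μ : R → ℝ) (t : ℝ) (x q : RealSpace N) : ℝ :=
  Real.exp (-(‖x‖ ^ 2 + ‖q‖ ^ 2) / (2 * t)) *
    (dunklKernel μ (toComplex ((Real.sqrt t)⁻¹ • x)) (toComplex ((Real.sqrt t)⁻¹ • q))).re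

/-- `F` is a holomorphic continuation to `ℂ^N × ℂ^N` of the function `f` on `ℝ^N × ℝ^N`. -/
structure IsHolomorphicContinuation {N : ℕ} (f : RealSpace N → RealSpace N → ℝ)
    (F : ComplexSpace N → ComplexSpace N → ℂ) : Prop where
  holomorphic : IsHolomorphic F
  extends_real : ∀ x y : RealSpace N, F (toComplex x) (toComplex y) = (f x y : ℂ)

/-- The holomorphic continuation of the Dunkl heat kernel to `ℂ^N × ℂ^N`. -/
def heatKernelC {N : ℕ} {R : Finset (RealSpace N)} (μ : R → ℝ) (t : ℝ) :
    ComplexSpace N → ComplexSpace N → ℂ :=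
  Classical.epsilon (IsHolomorphicContinuation (heatKernel μ t))

/-- The kernel `A_{μ,t}(z, q) = exp (-z^2 / 2t - q^2 / 4t) E_μ(z / t^{1/2}, q / t^{1/2})` of the
Version A Segal–Bargmann transform. -/
def versionAKernel {N : ℕ} {R : Finset (RealSpace N)} (μ : R → ℝ) (t : ℝ)
    (z : ComplexSpace N) (q : RealSpace N) : ℂ :=
  Complex.exp (-bilinSq z / (2 * (t : ℂ)) - ((‖q‖ ^ 2 : ℝ) : ℂ) / (4 * (t : ℂ))) *
    dunklKernel μ ((((Real.sqrt t)⁻¹ : ℝ) : ℂ) • z) (toComplex ((Real.sqrt t)⁻¹ • q))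

end Dunkl

end

noncomputable section

namespace Dunkl

/-! ### Roots and reflections -/

section Roots

variable {N : ℕ} {R : Finset (RealSpace N)}

/-! Once the Dunkl kernel is known to exist, the theorem is short. Since `E(0, y) = 1`, the heat
kernel at `(0, q)` is `exp(-‖q‖²/2t)`, which is positive and has square root `exp(-‖q‖²/4t)`. A
holomorphic continuation from the real points is unique (`eq_of_eq_on_real`), so `heatKernelC` is
the evident formula, and dividing the exponentials gives the Version A kernel. Almost all of the
work is the existence of `E`.

The kernel is built as a series of components `E_n`, homogeneous of degree `n` in `x`, with `E_0 =
1` and `T_ξ E_{n+1} = ⟨ξ, y⟩ E_n`. Putting `ξ = x` cancels the denominators in `T_ξ` and leaves an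
equation on the orbit of `x` under the reflection group: `(n+1) E_{n+1} + ½ ∑ μ(α) (E_{n+1}(x) -
E_{n+1}(σ_α x)) = ⟨x, y⟩ E_n`. As `μ ≥ 0`, the operator on the left obeys a maximum principle. It is
therefore invertible, and its Green function is nonnegative with total mass `1/(n+1)`
(`exists_nonneg_mul_add_sum_sub_eq`). This defines `E_{n+1}` as a weighted sum over the group and
gives `|E_n(z, w)| ≤ (‖z‖‖w‖)^n / n!`, so the series converges to an entire function.

It remains to recover the full equation from the contracted one
(`IsRegular.dunklOperator_eq_of_contraction`). The defect `F_ξ = T_ξ E_{n+1} - ⟨ξ, y⟩ E_n` satisfies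
`F_x(x) = 0`. Commutativity of the Dunkl operators turns this into a homogeneous equation of the
same type for `F`, and the maximum principle forces `F = 0`. The operators are handled at regular
points; density and continuity then give the equation on the reflecting hyperplanes. -/

theorem IsRootSystem.reflection_apply (hR : IsRootSystem R) (β : R) (x : RealSpace N) :
    rootReflection (β : RealSpace N) x = x - inner ℝ (β : RealSpace N) x • (β : RealSpace N) := by
  rw [rootReflection_apply, hR.norm_sq β β.2, mul_div_cancel_left₀ _ two_ne_zero]

theorem IsRootSystem.inner_self (hR : IsRootSystem R) (β : R) :
    inner ℝ (β : RealSpace N) (β : RealSpace N) = 2 := by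
  rw [real_inner_self_eq_norm_sq, hR.norm_sq β β.2]

@[simp]
theorem rootReflection_rootReflection (α x : RealSpace N) :
    rootReflection α (rootReflection α x) = x :=
  Submodule.reflection_reflection _ _

theorem inner_rootReflection (α x y : RealSpace N) :
    inner ℝ (rootReflection α x) y = inner ℝ x (rootReflection α y) := by
  rw [← LinearIsometryEquiv.inner_map_map (rootReflection α) x, rootReflection_rootReflection]

theorem IsRootSystem.reflection_mem (hR : IsRootSystem R) (β α : R) :
    rootReflection (β : RealSpace N) α ∈ R := by
  have h := hR.reflection_image β β.2
  have : rootReflection (β : RealSpace N) α ∈ (R : Set (RealSpace N)) := by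
    rw [← h]
    exact Set.mem_image_of_mem _ α.2
  exact this

/-- The permutation of the roots induced by the reflection `σ_β`. -/
def IsRootSystem.rootPerm (hR : IsRootSystem R) (β : R) : Equiv.Perm R :=
  Function.Involutive.toPerm (fun α => ⟨rootReflection (β : RealSpace N) α, hR.reflection_mem β α⟩)
    (fun _ => Subtype.ext (rootReflection_rootReflection _ _))

@[simp]
theorem IsRootSystem.coe_rootPerm (hR : IsRootSystem R) (β α : R) :
    (hR.rootPerm β α : RealSpace N) = rootReflection (β : RealSpace N) α := rfl

theorem IsRootSystem.rootReflection_rootPerm (hR : IsRootSystem R) (β γ : R) (x : RealSpace N) :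
    rootReflection (hR.rootPerm β γ : RealSpace N) x =
      rootReflection (β : RealSpace N) (rootReflection (γ : RealSpace N)
        (rootReflection (β : RealSpace N) x)) := by
  rw [hR.reflection_apply, hR.reflection_apply γ, map_sub, map_smul,
    rootReflection_rootReflection, hR.coe_rootPerm, inner_rootReflection]

theorem IsMultiplicityFunction.rootPerm {μ : R → ℝ} (hμ : IsMultiplicityFunction R μ)
    (hR : IsRootSystem R) (β α : R) : μ (hR.rootPerm β α) = μ α :=
  hμ (rootReflection (β : RealSpace N)) (Subgroup.subset_closure ⟨β, β.2, rfl⟩) _ _ rfl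

/-- A point of `ℝ^N` is regular if it lies on none of the reflecting hyperplanes. -/
def IsRegular (R : Finset (RealSpace N)) (x : RealSpace N) : Prop :=
  ∀ α ∈ R, inner ℝ α x ≠ 0

theorem IsRegular.ne_zero {x : RealSpace N} (hx : IsRegular R x) (α : R) :
    ((inner ℝ (α : RealSpace N) x : ℝ) : ℂ) ≠ 0 :=
  Complex.ofReal_ne_zero.2 (hx α α.2)

theorem IsRegular.reflection (hR : IsRootSystem R) {x : RealSpace N} (hx : IsRegular R x) (β : R) :
    IsRegular R (rootReflection (β : RealSpace N) x) := by
  intro α hα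
  rw [← inner_rootReflection]
  exact hx _ (hR.reflection_mem β ⟨α, hα⟩)

/-- The `2 × 2` minor of the pairings of two vectors with two others. -/
def pairingMinor (ξ η β γ : RealSpace N) : ℝ :=
  inner ℝ β ξ * inner ℝ γ η - inner ℝ β η * inner ℝ γ ξ

theorem pairingMinor_swap (ξ η β γ : RealSpace N) :
    pairingMinor ξ η γ β = -pairingMinor ξ η β γ := by
  unfold pairingMinor; ring

theorem IsRootSystem.pairingMinor_rootPerm (hR : IsRootSystem R) (ξ η : RealSpace N) (β γ : R) :
    pairingMinor ξ η β (hR.rootPerm β γ) = pairingMinor ξ η β γ := by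
  simp only [pairingMinor, hR.coe_rootPerm, hR.reflection_apply, inner_sub_left, inner_smul_left]
  simp only [conj_trivial]
  ring

/-- For a product `w` of two reflections, `rotationPotential w` is a function on the roots whose
differences give the coefficients `pairingMinor ξ η β γ / (⟨β, x⟩ ⟨γ, x⟩)` for all pairs of
non-orthogonal roots with `σ_β σ_γ = w`. -/
def rotationPotential (ξ η x : RealSpace N) (w : RealSpace N ≃ₗᵢ[ℝ] RealSpace N)
    (β : RealSpace N) : ℝ :=
  (inner ℝ ξ (w η) - inner ℝ η (w ξ)) / ‖w x - w.symm x‖ ^ 2 *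
    (inner ℝ β (w x - w.symm x) / inner ℝ β x)

/-- With `b = ⟨β, x⟩`, `g = ⟨γ, x⟩`, `c = ⟨β, γ⟩` and `w = σ_β σ_γ`, the vector `w x - w⁻¹ x` equals
`c u` with `u = g β - b γ`, and the antisymmetric part of `w` paired with `ξ, η` is `c` times the
minor. The claim then rests on `‖u‖² = g⟨β, u⟩ - b⟨γ, u⟩`, that is, `⟨β, u⟩/b - ⟨γ, u⟩/g = ‖u‖²/(b
g)`. -/
theorem rotationPotential_sub (hR : IsRootSystem R) {x : RealSpace N} (hx : IsRegular R x)
    (ξ η : RealSpace N) (β γ : R) :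
    rotationPotential ξ η x (rootReflection β * rootReflection γ) β -
        rotationPotential ξ η x (rootReflection β * rootReflection γ) γ =
      if inner ℝ (β : RealSpace N) (γ : RealSpace N) = 0 then 0 else
        pairingMinor ξ η β γ /
          (inner ℝ (β : RealSpace N) x * inner ℝ (γ : RealSpace N) x) := by
  have hb := hx β β.2
  have hg := hx γ γ.2
  have hbb := hR.inner_self β
  have hgg := hR.inner_self γ
  have hW : inner ℝ ξ ((rootReflection (β : RealSpace N) * rootReflection (γ : RealSpace N)) η) -
      inner ℝ η ((rootReflection (β : RealSpace N) * rootReflection (γ : RealSpace N)) ξ) =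
      inner ℝ (β : RealSpace N) (γ : RealSpace N) * pairingMinor ξ η β γ := by
    simp only [LinearIsometryEquiv.coe_mul, Function.comp_apply, hR.reflection_apply,
      inner_sub_right, inner_smul_right, pairingMinor]
    rw [real_inner_comm ξ η, real_inner_comm (β : RealSpace N) ξ,
      real_inner_comm (β : RealSpace N) η, real_inner_comm (γ : RealSpace N) ξ, real_inner_comm (γ : RealSpace N) η]
    ring
  have hv : (rootReflection (β : RealSpace N) * rootReflection (γ : RealSpace N)) x -
      (rootReflection (β : RealSpace N) * rootReflection (γ : RealSpace N)).symm x =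
      inner ℝ (β : RealSpace N) (γ : RealSpace N) •
        (inner ℝ (γ : RealSpace N) x • (β : RealSpace N) -
          inner ℝ (β : RealSpace N) x • (γ : RealSpace N)) := by
    have hs : (rootReflection (β : RealSpace N) * rootReflection (γ : RealSpace N)).symm x =
        rootReflection (γ : RealSpace N) (rootReflection (β : RealSpace N) x) := by
      rw [LinearIsometryEquiv.symm_apply_eq]
      simp
    rw [hs]
    simp only [LinearIsometryEquiv.coe_mul, Function.comp_apply, hR.reflection_apply,
      inner_sub_right, inner_smul_right, real_inner_comm (β : RealSpace N) (γ : RealSpace N)]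
    module
  simp only [rotationPotential, hW, hv]
  rw [← real_inner_comm (β : RealSpace N) (γ : RealSpace N)] at *
  set c := inner ℝ (γ : RealSpace N) (β : RealSpace N) with hc
  by_cases hc0 : c = 0
  · simp [hc0]
  rw [if_neg hc0]
  set u := inner ℝ (γ : RealSpace N) x • (β : RealSpace N) -
          inner ℝ (β : RealSpace N) x • (γ : RealSpace N) with hu
  set b := inner ℝ (β : RealSpace N) x
  set g := inner ℝ (γ : RealSpace N) x
  have hbu : inner ℝ (β : RealSpace N) u = 2 * g - b * c := by
    rw [hu, inner_sub_right, inner_smul_right, inner_smul_right, hbb, real_inner_comm, ← hc]; ring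
  have hgu : inner ℝ (γ : RealSpace N) u = g * c - 2 * b := by
    rw [hu, inner_sub_right, inner_smul_right, inner_smul_right, hgg, ← hc]; ring
  -- If `u = 0` the two roots are proportional, so the minor vanishes, and both potentials are zero.
  by_cases hu0 : u = 0
  · have : pairingMinor ξ η β γ = 0 := by
      have h1 : (β : RealSpace N) = (b / g) • (γ : RealSpace N) := by
        rw [div_eq_inv_mul, mul_smul, ← sub_eq_zero.1 (hu.symm.trans hu0), smul_smul,
          inv_mul_cancel₀ hg, one_smul]
      unfold pairingMinor
      rw [h1]
      simp only [inner_smul_left, conj_trivial]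
      ring
    rw [this, hu0]
    simp
  · have huu : inner ℝ u u = g * (2 * g - b * c) - b * (g * c - 2 * b) := by
      conv_lhs => rw [hu]
      rw [← hu, inner_sub_left, inner_smul_left, inner_smul_left, hbu, hgu]
      rfl
    have hne : ‖u‖ ^ 2 ≠ 0 := pow_ne_zero 2 (norm_ne_zero_iff.2 hu0)
    have h2 : ‖u‖ ^ 2 = g * (2 * g - b * c) - b * (g * c - 2 * b) := by
      rw [← huu, real_inner_self_eq_norm_sq]
    rw [norm_smul, mul_pow, inner_smul_right, inner_smul_right, hbu, hgu, Real.norm_eq_abs, sq_abs]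
    generalize ‖u‖ ^ 2 = U at *
    field_simp
    rw [h2]
    ring

/-- This cancellation is the core of the commutativity of Dunkl operators. For orthogonal roots
`σ_β` and `σ_γ` commute while the minor changes sign under exchange. For the other pairs the
coefficient is a difference of potentials depending only on `w = σ_β σ_γ` and one root, and the sum
telescopes because the pairs with a given product are permuted among themselves. -/
theorem sum_pairingMinor_rotation (hR : IsRootSystem R) {μ : R → ℝ}
    (hμ : IsMultiplicityFunction R μ) {x : RealSpace N} (hx : IsRegular R x)
    (ξ η : RealSpace N) (f : RealSpace N → ℂ) :
    ∑ β : R, ∑ γ : R, ((μ β * μ γ * (pairingMinor ξ η β γ /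
        (inner ℝ (β : RealSpace N) x * inner ℝ (γ : RealSpace N) x)) : ℝ) : ℂ) *
      f (rootReflection (β : RealSpace N) (rootReflection (γ : RealSpace N) x)) = 0 := by
  set w : R → R → (RealSpace N ≃ₗᵢ[ℝ] RealSpace N) :=
    fun β γ => rootReflection (β : RealSpace N) * rootReflection (γ : RealSpace N) with hw
  set P : R → R → ℝ := fun β γ => if inner ℝ (β : RealSpace N) (γ : RealSpace N) = 0 then
    pairingMinor ξ η β γ / (inner ℝ (β : RealSpace N) x * inner ℝ (γ : RealSpace N) x) else 0
    with hP
  have hsplit : ∀ β γ : R, ((μ β * μ γ * (pairingMinor ξ η β γ /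
        (inner ℝ (β : RealSpace N) x * inner ℝ (γ : RealSpace N) x)) : ℝ) : ℂ) *
      f (rootReflection (β : RealSpace N) (rootReflection (γ : RealSpace N) x)) =
      ((μ β * μ γ * P β γ : ℝ) : ℂ) * f (w β γ x) +
      (((μ β * μ γ * rotationPotential ξ η x (w β γ) β : ℝ) : ℂ) * f (w β γ x) -
      ((μ β * μ γ * rotationPotential ξ η x (w β γ) γ : ℝ) : ℂ) * f (w β γ x)) := by
    intro β γ
    rw [← sub_mul, ← add_mul, ← Complex.ofReal_sub, ← mul_sub, rotationPotential_sub hR hx,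
      ← Complex.ofReal_add, ← mul_add]
    simp only [hP, hw, LinearIsometryEquiv.coe_mul, Function.comp_apply]
    split_ifs <;> simp
  have h1 : ∑ β : R, ∑ γ : R, ((μ β * μ γ * P β γ : ℝ) : ℂ) * f (w β γ x) = 0 := by
    have : ∑ β : R, ∑ γ : R, ((μ β * μ γ * P β γ : ℝ) : ℂ) * f (w β γ x) =
        -∑ β : R, ∑ γ : R, ((μ β * μ γ * P β γ : ℝ) : ℂ) * f (w β γ x) := by
      conv_lhs => rw [Finset.sum_comm]
      rw [← Finset.sum_neg_distrib]
      refine Finset.sum_congr rfl fun β _ => ?_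
      rw [← Finset.sum_neg_distrib]
      refine Finset.sum_congr rfl fun γ _ => ?_
      by_cases h : inner ℝ (β : RealSpace N) (γ : RealSpace N) = 0
      · have h' : inner ℝ (γ : RealSpace N) (β : RealSpace N) = 0 := by rwa [real_inner_comm]
        have hwx : w γ β x = w β γ x := by
          simp only [hw, LinearIsometryEquiv.coe_mul, Function.comp_apply, hR.reflection_apply,
            inner_sub_right, inner_smul_right, h, h']
          module
        simp only [hP, if_pos h, if_pos h', hwx, pairingMinor_swap ξ η (β : RealSpace N)]
        rw [← neg_mul, ← Complex.ofReal_neg]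
        congr 2
        ring
      · have h' : inner ℝ (γ : RealSpace N) (β : RealSpace N) ≠ 0 := by rwa [real_inner_comm]
        simp [hP, if_neg h, if_neg h']
    exact self_eq_neg.1 this
  have h2 : ∑ β : R, ∑ γ : R,
      ((μ β * μ γ * rotationPotential ξ η x (w β γ) β : ℝ) : ℂ) * f (w β γ x) =
      ∑ β : R, ∑ γ : R,
      ((μ β * μ γ * rotationPotential ξ η x (w β γ) γ : ℝ) : ℂ) * f (w β γ x) := by
    conv_rhs => rw [Finset.sum_comm]
    refine Finset.sum_congr rfl fun γ _ => ?_
    -- The substitution `(β, γ) ↦ (γ, σ_γ β)` preserves the product of reflections, since `σ_γ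
    -- σ_{σ_γ β} = σ_β σ_γ`, and it preserves the weights by invariance of `μ`.
    rw [← Equiv.sum_comp (hR.rootPerm γ)]
    refine Finset.sum_congr rfl fun β _ => ?_
    have hww : w γ (hR.rootPerm γ β) = w β γ := by
      ext1 v
      simp only [hw, LinearIsometryEquiv.coe_mul, Function.comp_apply, hR.rootReflection_rootPerm,
        rootReflection_rootReflection]
    rw [hww, hμ.rootPerm hR, mul_comm (μ γ)]
  simp only [hsplit, Finset.sum_add_distrib, Finset.sum_sub_distrib]
  rw [h1, h2, sub_self, add_zero]

/-- This is the part of the commutator quadratic in `μ`. Expanding the quotients leaves values of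
`f` at `x`, `σ_β x`, `σ_γ x` and `σ_β σ_γ x`. The first three cancel by antisymmetry of the
coefficients, the last by `sum_pairingMinor_rotation`. -/
theorem sum_reflectionQuotient_comm (hR : IsRootSystem R) {μ : R → ℝ}
    (hμ : IsMultiplicityFunction R μ) {x : RealSpace N} (hx : IsRegular R x)
    (ξ η : RealSpace N) (f : RealSpace N → ℂ) :
    ∑ β : R, ∑ α : R, ((μ β * μ α * pairingMinor ξ η β α : ℝ) : ℂ) *
      ((reflectionQuotient (α : RealSpace N) f x -
        reflectionQuotient (α : RealSpace N) f (rootReflection (β : RealSpace N) x)) /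
          ((inner ℝ (β : RealSpace N) x : ℝ) : ℂ)) = 0 := by
  set C : R → R → ℂ := fun β γ => ((μ β * μ γ * (pairingMinor ξ η β γ /
        (inner ℝ (β : RealSpace N) x * inner ℝ (γ : RealSpace N) x)) : ℝ) : ℂ) with hC
  have hCs : ∀ β γ, C γ β = -C β γ := by
    intro β γ
    simp only [hC, pairingMinor_swap ξ η (β : RealSpace N), ← Complex.ofReal_neg]
    congr 1
    ring
  have h0 := sum_pairingMinor_rotation hR hμ hx ξ η f
  have hq : ∀ z, IsRegular R z → ∀ α : R, reflectionQuotient (α : RealSpace N) f z =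
      (f z - f (rootReflection (α : RealSpace N) z)) /
        ((inner ℝ (α : RealSpace N) z : ℝ) : ℂ) := fun z hz α => if_neg (hz α α.2)
  have h1 : ∀ β : R, ∑ α : R, ((μ β * μ α * pairingMinor ξ η β α : ℝ) : ℂ) *
      (reflectionQuotient (α : RealSpace N) f (rootReflection (β : RealSpace N) x) /
          ((inner ℝ (β : RealSpace N) x : ℝ) : ℂ)) =
      ∑ γ : R, C β γ * (f (rootReflection (β : RealSpace N) x) -
        f (rootReflection (β : RealSpace N) (rootReflection (γ : RealSpace N) x))) := by
    intro β
    -- Writing `α = σ_β γ` gives `⟨α, σ_β x⟩ = ⟨γ, x⟩` and `σ_α σ_β x = σ_β σ_γ x`, and leaves the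
    -- minor with `β` unchanged.
    rw [← Equiv.sum_comp (hR.rootPerm β)]
    refine Finset.sum_congr rfl fun γ _ => ?_
    rw [hq _ (hx.reflection hR β), hR.rootReflection_rootPerm, rootReflection_rootReflection,
      hR.coe_rootPerm, inner_rootReflection, rootReflection_rootReflection,
      hμ.rootPerm hR, ← hR.coe_rootPerm, hR.pairingMinor_rootPerm]
    simp only [hC]
    push_cast
    ring
  have h2 : ∀ β : R, ∑ α : R, ((μ β * μ α * pairingMinor ξ η β α : ℝ) : ℂ) *
      (reflectionQuotient (α : RealSpace N) f x /
          ((inner ℝ (β : RealSpace N) x : ℝ) : ℂ)) =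
      ∑ γ : R, C β γ * (f x - f (rootReflection (γ : RealSpace N) x)) := by
    intro β
    refine Finset.sum_congr rfl fun γ _ => ?_
    rw [hq _ hx]
    simp only [hC]
    push_cast
    ring
  have h3 : ∑ β : R, ∑ γ : R, C β γ * (f x - f (rootReflection (γ : RealSpace N) x) -
      f (rootReflection (β : RealSpace N) x)) = 0 := by
    refine self_eq_neg.1 ?_
    conv_lhs => rw [Finset.sum_comm]
    rw [← Finset.sum_neg_distrib]
    refine Finset.sum_congr rfl fun β _ => ?_
    rw [← Finset.sum_neg_distrib]
    refine Finset.sum_congr rfl fun γ _ => ?_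
    rw [hCs]
    ring
  simp only [sub_div, mul_sub, Finset.sum_sub_distrib]
  rw [Finset.sum_congr rfl fun β _ => h1 β, Finset.sum_congr rfl fun β _ => h2 β]
  refine Eq.trans ?_ ((congrArg₂ (· + ·) h3 h0).trans (add_zero 0))
  simp only [← Finset.sum_sub_distrib, ← Finset.sum_add_distrib]
  refine Finset.sum_congr rfl fun β _ => Finset.sum_congr rfl fun γ _ => ?_
  ring

end Roots

/-! ### The reflection group -/

section Group

variable {N : ℕ} {R : Finset (RealSpace N)}

theorem IsRootSystem.image_of_mem_coxeterGroup (hR : IsRootSystem R)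
    {g : RealSpace N ≃ₗᵢ[ℝ] RealSpace N} (hg : g ∈ coxeterGroup R) :
    g '' (R : Set (RealSpace N)) = R := by
  induction hg using Subgroup.closure_induction with
  | mem g hg =>
    obtain ⟨α, hα, rfl⟩ := hg
    exact hR.reflection_image α hα
  | one => simp
  | mul g h _ _ hg hh => rw [LinearIsometryEquiv.coe_mul, Set.image_comp, hh, hg]
  | inv g _ hg =>
    conv_lhs => rw [← hg]
    rw [← Set.image_comp, ← LinearIsometryEquiv.coe_mul, inv_mul_cancel]
    simp

theorem apply_eq_self_of_mem_coxeterGroup {g : RealSpace N ≃ₗᵢ[ℝ] RealSpace N}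
    (hg : g ∈ coxeterGroup R) {v : RealSpace N} (hv : ∀ α ∈ R, inner ℝ α v = 0) : g v = v := by
  induction hg using Subgroup.closure_induction with
  | mem g hg =>
    obtain ⟨α, hα, rfl⟩ := hg
    rw [rootReflection_apply, hv α hα]
    simp
  | one => simp
  | mul g h _ _ hg hh => rw [LinearIsometryEquiv.coe_mul, Function.comp_apply, hh, hg]
  | inv g _ hg =>
    conv_lhs => rw [← hg]
    change (g⁻¹ * g) v = v
    rw [inv_mul_cancel]
    rfl

/-- The group acts faithfully on the finite set of roots: the action on roots determines an element
on their span, and every element fixes the orthogonal complement. -/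
theorem IsRootSystem.finite_coxeterGroup (hR : IsRootSystem R) : Finite (coxeterGroup R) := by
  have hmem : ∀ (g : coxeterGroup R) (α : R), (g : RealSpace N ≃ₗᵢ[ℝ] RealSpace N) α ∈ R := by
    intro g α
    have : (g : RealSpace N ≃ₗᵢ[ℝ] RealSpace N) α ∈ (R : Set (RealSpace N)) := by
      rw [← hR.image_of_mem_coxeterGroup g.2]
      exact Set.mem_image_of_mem _ α.2
    exact this
  refine Finite.of_injective (fun (g : coxeterGroup R) (α : R) => (⟨_, hmem g α⟩ : R)) ?_
  intro g h hgh
  have hroot : ∀ α ∈ R, (g : RealSpace N ≃ₗᵢ[ℝ] RealSpace N) α =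
      (h : RealSpace N ≃ₗᵢ[ℝ] RealSpace N) α := fun α hα =>
    congrArg Subtype.val (congrFun hgh ⟨α, hα⟩)
  have hspan : ∀ u ∈ Submodule.span ℝ (R : Set (RealSpace N)),
      (g : RealSpace N ≃ₗᵢ[ℝ] RealSpace N) u = (h : RealSpace N ≃ₗᵢ[ℝ] RealSpace N) u := by
    intro u hu
    induction hu using Submodule.span_induction with
    | mem u hu => exact hroot u hu
    | zero => simp
    | add u v _ _ hu hv => rw [map_add, map_add, hu, hv]
    | smul r u _ hu => rw [map_smul, map_smul, hu]
  refine Subtype.ext (LinearIsometryEquiv.ext fun x => ?_)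
  obtain ⟨u, hu, v, hv, rfl⟩ :=
    (Submodule.span ℝ (R : Set (RealSpace N))).exists_add_mem_mem_orthogonal x
  have hv' : ∀ α ∈ R, inner ℝ α v = 0 := fun α hα =>
    (Submodule.mem_orthogonal _ v).1 hv α (Submodule.subset_span hα)
  rw [map_add, map_add, hspan u hu, apply_eq_self_of_mem_coxeterGroup g.2 hv',
    apply_eq_self_of_mem_coxeterGroup h.2 hv']

/-- The reflection `σ_α` as an element of the reflection group. -/
def groupReflection (α : R) : coxeterGroup R :=
  ⟨rootReflection (α : RealSpace N), Subgroup.subset_closure ⟨α, α.2, rfl⟩⟩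

end Group

/-! ### A maximum principle for weighted permutations -/

section MaximumPrinciple

variable {G ι : Type*} [Finite G] [Fintype ι] {k : ι → ℝ} (p : ι → G → G)

/-- At a point `m` where `‖h‖` is maximal, `(r + ∑ k) h(m)` is a sum of values of norm at most `‖h
m‖` with total weight only `∑ k`. Since `r > 0`, this forces `h m = 0`. -/
theorem eq_zero_of_mul_add_sum_sub_eq_zero {F : Type*} [NormedAddCommGroup F] [NormedSpace ℝ F]
    (hk : ∀ i, 0 ≤ k i) {r : ℝ} (hr : 0 < r) (h : G → F)
    (hh : ∀ g, r • h g + ∑ i, k i • (h g - h (p i g)) = 0) (g : G) : h g = 0 := by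
  have : Nonempty G := ⟨g⟩
  obtain ⟨m, hm⟩ := Finite.exists_max fun g => ‖h g‖
  suffices h0 : ‖h m‖ ≤ 0 from norm_le_zero_iff.1 ((hm g).trans h0)
  have h1 : (r + ∑ i, k i) • h m = ∑ i, k i • h (p i m) := by
    have := hh m
    simp only [smul_sub, Finset.sum_sub_distrib, ← Finset.sum_smul] at this
    rw [add_smul, ← sub_eq_zero, ← this]
    abel
  have hK : 0 ≤ ∑ i, k i := Finset.sum_nonneg fun i _ => hk i
  have h2 : (r + ∑ i, k i) * ‖h m‖ ≤ (∑ i, k i) * ‖h m‖ := by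
    calc (r + ∑ i, k i) * ‖h m‖ = ‖(r + ∑ i, k i) • h m‖ := by
          rw [norm_smul, Real.norm_of_nonneg (by positivity)]
      _ ≤ ∑ i, ‖k i • h (p i m)‖ := by rw [h1]; exact norm_sum_le _ _
      _ ≤ ∑ i, k i * ‖h m‖ := Finset.sum_le_sum fun i _ => by
          rw [norm_smul, Real.norm_of_nonneg (hk i)]
          exact mul_le_mul_of_nonneg_left (hm _) (hk i)
      _ = (∑ i, k i) * ‖h m‖ := (Finset.sum_mul _ _ _).symm
  nlinarith [norm_nonneg (h m)]

/-- The operator is injective by the previous lemma, hence surjective in finite dimension.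
Nonnegativity is read off at a minimum of `c`. Summing over `G` kills the differences, because each
`p i` is a permutation, and this gives the total mass. -/
theorem exists_nonneg_mul_add_sum_sub_eq [Fintype G] (p : ι → Equiv.Perm G)
    (hk : ∀ i, 0 ≤ k i) {r : ℝ} (hr : 0 < r) (b : G → ℝ) (hb : ∀ g, 0 ≤ b g) :
    ∃ c : G → ℝ, (∀ g, 0 ≤ c g) ∧ (∑ g, c g = (∑ g, b g) / r) ∧
      ∀ g, r * c g + ∑ i, k i * (c g - c (p i g)) = b g := by
  let A : (G → ℝ) →ₗ[ℝ] (G → ℝ) :=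
    { toFun := fun c g => r * c g + ∑ i, k i * (c g - c (p i g))
      map_add' := fun c d => by
        ext g
        simp only [Pi.add_apply]
        rw [add_add_add_comm, ← Finset.sum_add_distrib, ← mul_add]
        congr 1
        exact Finset.sum_congr rfl fun i _ => by ring
      map_smul' := fun s c => by
        ext g
        simp only [Pi.smul_apply, smul_eq_mul, RingHom.id_apply, mul_add, Finset.mul_sum]
        congr 1
        · ring
        · exact Finset.sum_congr rfl fun i _ => by ring }
  have hA : Function.Injective A := by
    rw [injective_iff_map_eq_zero]
    intro c hc
    ext g
    exact eq_zero_of_mul_add_sum_sub_eq_zero (fun i => p i) hk hr c (fun g => congrFun hc g) g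
  obtain ⟨c, hc⟩ := LinearMap.injective_iff_surjective.1 hA b
  have hc' : ∀ g, r * c g + ∑ i, k i * (c g - c (p i g)) = b g := fun g => congrFun hc g
  refine ⟨c, fun g => ?_, ?_, hc'⟩
  · have : Nonempty G := ⟨g⟩
    obtain ⟨m, hm⟩ := Finite.exists_min c
    refine le_trans ?_ (hm g)
    have h1 : ∑ i, k i * (c m - c (p i m)) ≤ 0 := Finset.sum_nonpos fun i _ =>
      mul_nonpos_of_nonneg_of_nonpos (hk i) (sub_nonpos.2 (hm _))
    have h2 : 0 ≤ r * c m := by linarith [hc' m, hb m]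
    exact nonneg_of_mul_nonneg_right h2 hr
  · rw [eq_div_iff hr.ne', mul_comm, Finset.mul_sum]
    rw [← Finset.sum_congr rfl fun g _ => hc' g, Finset.sum_add_distrib, left_eq_add,
      Finset.sum_comm]
    refine Finset.sum_eq_zero fun i _ => ?_
    rw [← Finset.mul_sum, Finset.sum_sub_distrib, Equiv.sum_comp (p i) c, sub_self, mul_zero]

end MaximumPrinciple

/-! ### Dunkl operators at regular points -/

section Operators

open Filter Topology

variable {N : ℕ} {R : Finset (RealSpace N)} {μ : R → ℝ}

theorem isOpen_isRegular (R : Finset (RealSpace N)) : IsOpen {x | IsRegular R x} := by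
  simp only [IsRegular, Set.ofPred_forall]
  exact isOpen_biInter_finset fun α _ =>
    isOpen_ne_fun (continuous_const.inner continuous_id) continuous_const

theorem IsRegular.eventually {x : RealSpace N} (hx : IsRegular R x) : ∀ᶠ z in 𝓝 x, IsRegular R z :=
  (isOpen_isRegular R).mem_nhds hx

theorem IsRegular.smul {x : RealSpace N} (hx : IsRegular R x) {s : ℝ} (hs : s ≠ 0) :
    IsRegular R (s • x) := fun α hα => by
  rw [inner_smul_right]
  exact mul_ne_zero hs (hx α hα)

theorem IsRegular.map (hR : IsRootSystem R) {x : RealSpace N} (hx : IsRegular R x)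
    (g : coxeterGroup R) : IsRegular R ((g : RealSpace N ≃ₗᵢ[ℝ] RealSpace N) x) := by
  intro α hα
  have h : α ∈ (R : Set (RealSpace N)) := hα
  rw [← hR.image_of_mem_coxeterGroup g.2] at h
  obtain ⟨β, hβ, rfl⟩ := h
  rw [LinearIsometryEquiv.inner_map_map]
  exact hx β hβ

theorem IsRegular.reflectionQuotient_eq {x : RealSpace N} (hx : IsRegular R x) (α : R)
    (f : RealSpace N → ℂ) : reflectionQuotient (α : RealSpace N) f x =
      (f x - f (rootReflection (α : RealSpace N) x)) / ((inner ℝ (α : RealSpace N) x : ℝ) : ℂ) :=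
  if_neg (hx α α.2)

theorem IsRegular.hasFDerivAt_reflectionQuotient {x : RealSpace N} (hx : IsRegular R x) (α : R)
    {f : RealSpace N → ℂ} (hf : DifferentiableAt ℝ f x)
    (hf' : DifferentiableAt ℝ f (rootReflection (α : RealSpace N) x)) :
    HasFDerivAt (reflectionQuotient (α : RealSpace N) f)
      ((inner ℝ (α : RealSpace N) x)⁻¹ • (fderiv ℝ f x -
        (fderiv ℝ f (rootReflection (α : RealSpace N) x)).comp
          (rootReflection (α : RealSpace N) : RealSpace N →L[ℝ] RealSpace N)) +
        (-(inner ℝ (α : RealSpace N) x ^ 2)⁻¹ • innerSL ℝ (α : RealSpace N)).smulRight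
          (f x - f (rootReflection (α : RealSpace N) x))) x := by
  have h1 : HasFDerivAt (fun z : RealSpace N => (inner ℝ (α : RealSpace N) z)⁻¹)
      (-(inner ℝ (α : RealSpace N) x ^ 2)⁻¹ • innerSL ℝ (α : RealSpace N)) x :=
    (hasDerivAt_inv (hx α α.2)).comp_hasFDerivAt x (innerSL ℝ (α : RealSpace N)).hasFDerivAt
  have h2 : HasFDerivAt (fun z => f z - f (rootReflection (α : RealSpace N) z)) _ x :=
    hf.hasFDerivAt.sub (hf'.hasFDerivAt.comp x
      (rootReflection (α : RealSpace N) : RealSpace N →L[ℝ] RealSpace N).hasFDerivAt)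
  refine (h1.smul h2).congr_of_eventuallyEq ?_
  filter_upwards [hx.eventually] with z hz
  rw [hz.reflectionQuotient_eq]
  simp only [Pi.smul_apply', Complex.real_smul, Complex.ofReal_inv]
  rw [div_eq_inv_mul]

theorem IsRegular.fderiv_reflectionQuotient_apply (hR : IsRootSystem R) {x : RealSpace N}
    (hx : IsRegular R x) (α : R) {f : RealSpace N → ℂ} (hf : DifferentiableAt ℝ f x)
    (hf' : DifferentiableAt ℝ f (rootReflection (α : RealSpace N) x)) (η : RealSpace N) :
    fderiv ℝ (reflectionQuotient (α : RealSpace N) f) x η =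
      (fderiv ℝ f x η - fderiv ℝ f (rootReflection (α : RealSpace N) x) η +
        ((inner ℝ (α : RealSpace N) η : ℝ) : ℂ) *
          fderiv ℝ f (rootReflection (α : RealSpace N) x) α) /
            ((inner ℝ (α : RealSpace N) x : ℝ) : ℂ) -
      ((inner ℝ (α : RealSpace N) η : ℝ) : ℂ) *
        (f x - f (rootReflection (α : RealSpace N) x)) /
          ((inner ℝ (α : RealSpace N) x : ℝ) : ℂ) ^ 2 := by
  rw [(hx.hasFDerivAt_reflectionQuotient α hf hf').fderiv]
  have h : (rootReflection (α : RealSpace N) : RealSpace N →L[ℝ] RealSpace N) η =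
      η - inner ℝ (α : RealSpace N) η • (α : RealSpace N) := hR.reflection_apply α η
  simp only [add_apply, smul_apply,
    sub_apply, ContinuousLinearMap.comp_apply, h, map_sub, map_smul,
    ContinuousLinearMap.smulRight_apply, Complex.real_smul, innerSL_apply_apply, smul_eq_mul]
  push_cast
  ring

theorem differentiable_fderiv_apply {f : RealSpace N → ℂ} (hf : ContDiff ℝ 2 f)
    (ξ : RealSpace N) : Differentiable ℝ fun z => fderiv ℝ f z ξ :=
  ((hf.fderiv_right (m := 1) le_rfl).differentiable one_ne_zero).clm_apply
    (differentiable_const ξ)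

theorem IsRegular.hasFDerivAt_dunklOperator {x : RealSpace N} (hx : IsRegular R x)
    {f : RealSpace N → ℂ} (hf : ContDiff ℝ 2 f) (ξ : RealSpace N) :
    HasFDerivAt (dunklOperator μ ξ f) (fderiv ℝ (fun z => fderiv ℝ f z ξ) x +
      (1 / 2 : ℂ) • ∑ α : R, ((μ α * inner ℝ (α : RealSpace N) ξ : ℝ) : ℂ) •
        fderiv ℝ (reflectionQuotient (α : RealSpace N) f) x) x := by
  have hf1 : Differentiable ℝ f := hf.differentiable two_ne_zero
  refine (differentiable_fderiv_apply hf ξ x).hasFDerivAt.add (HasFDerivAt.const_mul ?_ _)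
  refine HasFDerivAt.fun_sum fun α _ => HasFDerivAt.const_mul ?_ _
  exact (hx.hasFDerivAt_reflectionQuotient α (hf1 _) (hf1 _)).differentiableAt.hasFDerivAt

/-- The terms are grouped so that everything except the final double sum is visibly symmetric in `ξ`
and `η`, given the symmetry of second derivatives. -/
theorem IsRegular.dunklOperator_dunklOperator (hR : IsRootSystem R) {x : RealSpace N}
    (hx : IsRegular R x) {f : RealSpace N → ℂ} (hf : ContDiff ℝ 2 f) (ξ η : RealSpace N) :
    dunklOperator μ η (dunklOperator μ ξ f) x =
      fderiv ℝ (fun z => fderiv ℝ f z ξ) x η +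
      (1 / 2) * ∑ β : R, (μ β : ℂ) *
        ((((inner ℝ (β : RealSpace N) ξ : ℝ) : ℂ) * (fderiv ℝ f x η -
            fderiv ℝ f (rootReflection (β : RealSpace N) x) η) +
          ((inner ℝ (β : RealSpace N) η : ℝ) : ℂ) * (fderiv ℝ f x ξ -
            fderiv ℝ f (rootReflection (β : RealSpace N) x) ξ) +
          ((inner ℝ (β : RealSpace N) ξ : ℝ) : ℂ) * ((inner ℝ (β : RealSpace N) η : ℝ) : ℂ) *
            fderiv ℝ f (rootReflection (β : RealSpace N) x) β) /
            ((inner ℝ (β : RealSpace N) x : ℝ) : ℂ) -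
          ((inner ℝ (β : RealSpace N) ξ : ℝ) : ℂ) * ((inner ℝ (β : RealSpace N) η : ℝ) : ℂ) *
            (f x - f (rootReflection (β : RealSpace N) x)) /
              ((inner ℝ (β : RealSpace N) x : ℝ) : ℂ) ^ 2) +
      (1 / 4) * ∑ β : R, ∑ α : R,
        ((μ β * μ α * (inner ℝ (β : RealSpace N) η * inner ℝ (α : RealSpace N) ξ) : ℝ) : ℂ) *
        ((reflectionQuotient (α : RealSpace N) f x -
          reflectionQuotient (α : RealSpace N) f (rootReflection (β : RealSpace N) x)) /
            ((inner ℝ (β : RealSpace N) x : ℝ) : ℂ)) := by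
  have hf1 : Differentiable ℝ f := hf.differentiable two_ne_zero
  have h1 : fderiv ℝ (dunklOperator μ ξ f) x η = fderiv ℝ (fun z => fderiv ℝ f z ξ) x η +
      (1 / 2) * ∑ β : R, ((μ β * inner ℝ (β : RealSpace N) ξ : ℝ) : ℂ) *
        fderiv ℝ (reflectionQuotient (β : RealSpace N) f) x η := by
    rw [(hx.hasFDerivAt_dunklOperator hf ξ).fderiv]
    simp
  have h2 : ∀ β : R, reflectionQuotient (β : RealSpace N) (dunklOperator μ ξ f) x =
      (fderiv ℝ f x ξ - fderiv ℝ f (rootReflection (β : RealSpace N) x) ξ) /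
          ((inner ℝ (β : RealSpace N) x : ℝ) : ℂ) +
        (1 / 2) * ∑ α : R, ((μ α * inner ℝ (α : RealSpace N) ξ : ℝ) : ℂ) *
          ((reflectionQuotient (α : RealSpace N) f x -
            reflectionQuotient (α : RealSpace N) f (rootReflection (β : RealSpace N) x)) /
              ((inner ℝ (β : RealSpace N) x : ℝ) : ℂ)) := by
    intro β
    rw [hx.reflectionQuotient_eq β]
    simp only [dunklOperator, sub_div, mul_sub, Finset.sum_sub_distrib, ← mul_div_assoc,
      ← Finset.sum_div]
    ring
  have h3 : ∀ β : R, fderiv ℝ (reflectionQuotient (β : RealSpace N) f) x η = _ := fun β =>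
    hx.fderiv_reflectionQuotient_apply hR β (hf1 _) (hf1 _) η
  rw [dunklOperator, h1, add_assoc, add_assoc, ← mul_add, ← Finset.sum_add_distrib]
  congr 1
  have h4 : (1 / 4 : ℂ) = 1 / 2 * (1 / 2) := by norm_num
  rw [h4, mul_assoc, ← mul_add]
  congr 1
  rw [Finset.mul_sum, ← Finset.sum_add_distrib]
  refine Finset.sum_congr rfl fun β _ => ?_
  rw [h2, h3]
  have h5 : (1 / 2 : ℂ) * ∑ α : R,
        ((μ β * μ α * (inner ℝ (β : RealSpace N) η * inner ℝ (α : RealSpace N) ξ) : ℝ) : ℂ) *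
        ((reflectionQuotient (α : RealSpace N) f x -
          reflectionQuotient (α : RealSpace N) f (rootReflection (β : RealSpace N) x)) /
            ((inner ℝ (β : RealSpace N) x : ℝ) : ℂ)) =
      ((μ β * inner ℝ (β : RealSpace N) η : ℝ) : ℂ) * ((1 / 2) * ∑ α : R,
        ((μ α * inner ℝ (α : RealSpace N) ξ : ℝ) : ℂ) *
          ((reflectionQuotient (α : RealSpace N) f x -
            reflectionQuotient (α : RealSpace N) f (rootReflection (β : RealSpace N) x)) /
              ((inner ℝ (β : RealSpace N) x : ℝ) : ℂ))) := by
    rw [mul_left_comm, Finset.mul_sum (a := ((μ β * inner ℝ (β : RealSpace N) η : ℝ) : ℂ))]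
    congr 1
    refine Finset.sum_congr rfl fun α _ => ?_
    push_cast
    ring
  rw [h5]
  push_cast
  ring

/-- Dunkl operators commute on `C^2` functions, at every regular point. -/
theorem IsRegular.dunklOperator_comm (hR : IsRootSystem R) (hμ : IsMultiplicityFunction R μ)
    {x : RealSpace N} (hx : IsRegular R x) {f : RealSpace N → ℂ} (hf : ContDiff ℝ 2 f)
    (ξ η : RealSpace N) :
    dunklOperator μ η (dunklOperator μ ξ f) x = dunklOperator μ ξ (dunklOperator μ η f) x := by
  rw [hx.dunklOperator_dunklOperator hR hf, hx.dunklOperator_dunklOperator hR hf]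
  have h1 : fderiv ℝ (fun z => fderiv ℝ f z ξ) x η = fderiv ℝ (fun z => fderiv ℝ f z η) x ξ := by
    have hd : DifferentiableAt ℝ (fderiv ℝ f) x :=
      (hf.fderiv_right (m := 1) le_rfl).differentiable one_ne_zero x
    have hs : IsSymmSndFDerivAt ℝ f x :=
      hf.contDiffAt.isSymmSndFDerivAt (by simp)
    have h : ∀ ζ θ : RealSpace N, fderiv ℝ (fun z => fderiv ℝ f z ζ) x θ =
        fderiv ℝ (fderiv ℝ f) x θ ζ := by
      intro ζ θ
      rw [fderiv_clm_apply hd (differentiableAt_const ζ)]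
      simp
    rw [h, h, hs.eq]
  have h2 := sum_reflectionQuotient_comm hR hμ hx η ξ f
  simp only [pairingMinor, mul_sub, sub_mul, Complex.ofReal_sub, Finset.sum_sub_distrib] at h2
  rw [h1, sub_eq_zero.1 h2]
  congr 3
  refine Finset.sum_congr rfl fun β _ => ?_
  ring

theorem dunklOperator_add (ξ η : RealSpace N) (f : RealSpace N → ℂ) (x : RealSpace N) :
    dunklOperator μ (ξ + η) f x = dunklOperator μ ξ f x + dunklOperator μ η f x := by
  simp only [dunklOperator, map_add, inner_add_right, mul_add, Complex.ofReal_add, add_mul,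
    Finset.sum_add_distrib]
  ring

theorem dunklOperator_smul (s : ℝ) (ξ : RealSpace N) (f : RealSpace N → ℂ) (x : RealSpace N) :
    dunklOperator μ (s • ξ) f x = s * dunklOperator μ ξ f x := by
  simp only [dunklOperator, map_smul, inner_smul_right, Complex.real_smul, mul_add,
    Finset.mul_sum, Complex.ofReal_mul]
  congr 1
  exact Finset.sum_congr rfl fun α _ => by ring

theorem dunklOperator_const (ξ x : RealSpace N) (a : ℂ) :
    dunklOperator μ ξ (fun _ => a) x = 0 := by
  simp [dunklOperator, reflectionQuotient]

theorem IsRegular.dunklOperator_sub_const_mul {x : RealSpace N} (hx : IsRegular R x)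
    {f h : RealSpace N → ℂ} (hf : DifferentiableAt ℝ f x) (hh : DifferentiableAt ℝ h x) (c : ℂ)
    (ξ : RealSpace N) : dunklOperator μ ξ (fun z => f z - c * h z) x =
      dunklOperator μ ξ f x - c * dunklOperator μ ξ h x := by
  simp only [dunklOperator, hx.reflectionQuotient_eq]
  rw [fderiv_fun_sub hf (hh.const_mul c), fderiv_const_mul hh]
  simp only [sub_apply, smul_apply, smul_eq_mul]
  have h1 : ∑ α : R, ((μ α * inner ℝ (α : RealSpace N) ξ : ℝ) : ℂ) *
      ((f x - c * h x - (f (rootReflection (α : RealSpace N) x) -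
        c * h (rootReflection (α : RealSpace N) x))) / ((inner ℝ (α : RealSpace N) x : ℝ) : ℂ)) =
      ∑ α : R, ((μ α * inner ℝ (α : RealSpace N) ξ : ℝ) : ℂ) *
        ((f x - f (rootReflection (α : RealSpace N) x)) /
          ((inner ℝ (α : RealSpace N) x : ℝ) : ℂ)) -
      c * ∑ α : R, ((μ α * inner ℝ (α : RealSpace N) ξ : ℝ) : ℂ) *
        ((h x - h (rootReflection (α : RealSpace N) x)) /
          ((inner ℝ (α : RealSpace N) x : ℝ) : ℂ)) := by
    rw [Finset.mul_sum, ← Finset.sum_sub_distrib]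
    exact Finset.sum_congr rfl fun α _ => by ring
  rw [h1]
  ring

/-- Taking the direction equal to the point cancels every denominator `⟨α, x⟩`; the Euler field and
bounded reflection terms remain. -/
theorem IsRegular.dunklOperator_self {x : RealSpace N} (hx : IsRegular R x)
    (f : RealSpace N → ℂ) : dunklOperator μ x f x = fderiv ℝ f x x +
      (1 / 2) * ∑ α : R, (μ α : ℂ) * (f x - f (rootReflection (α : RealSpace N) x)) := by
  simp only [dunklOperator, hx.reflectionQuotient_eq]
  congr 2
  refine Finset.sum_congr rfl fun α _ => ?_
  have := hx.ne_zero α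
  push_cast
  field_simp

theorem fderiv_apply_self_of_homogeneous {f : RealSpace N → ℂ} {x : RealSpace N} {m : ℕ}
    (hf : DifferentiableAt ℝ f x) (hm : ∀ s : ℝ, 0 < s → f (s • x) = (s : ℂ) ^ m * f x) :
    fderiv ℝ f x x = m * f x := by
  have h1 : HasDerivAt (fun s : ℝ => f (s • x)) (fderiv ℝ f x x) 1 := by
    have hl : HasDerivAt (fun s : ℝ => s • x) x 1 := by
      simpa using (hasDerivAt_id (1 : ℝ)).smul_const x
    exact HasFDerivAt.comp_hasDerivAt (1 : ℝ) (by simpa using hf.hasFDerivAt) hl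
  have h2 : HasDerivAt (fun s : ℝ => (s : ℂ) ^ m * f x) (m * f x) 1 := by
    have := ((Complex.ofRealCLM.hasDerivAt (x := (1 : ℝ))).fun_pow m).mul_const (f x)
    simpa using this
  refine h1.unique (h2.congr_of_eventuallyEq ?_)
  filter_upwards [lt_mem_nhds one_pos] with s hs using hm s hs

theorem dunklOperator_smul_point {f : RealSpace N → ℂ} {m : ℕ}
    (hf : Differentiable ℝ f) (hm : ∀ (s : ℝ) x, f (s • x) = (s : ℂ) ^ (m + 1) * f x)
    (ξ : RealSpace N) {x : RealSpace N} (hx : IsRegular R x) {s : ℝ} (hs : s ≠ 0) :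
    dunklOperator μ ξ f (s • x) = (s : ℂ) ^ m * dunklOperator μ ξ f x := by
  have hs' : (s : ℂ) ≠ 0 := Complex.ofReal_ne_zero.2 hs
  have h1 : fderiv ℝ f (s • x) ξ = (s : ℂ) ^ m * fderiv ℝ f x ξ := by
    have h2 : HasFDerivAt (fun z => f (s • z)) ((fderiv ℝ f (s • x)).comp
        (s • ContinuousLinearMap.id ℝ (RealSpace N))) x :=
      HasFDerivAt.comp x (hf (s • x)).hasFDerivAt ((hasFDerivAt_id x).const_smul s)
    have h3 : HasFDerivAt (fun z => f (s • z)) ((s : ℂ) ^ (m + 1) • fderiv ℝ f x) x := by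
      simp only [hm]
      exact (hf x).hasFDerivAt.const_mul _
    have h4 := congrArg (fun A => A ξ) (h2.unique h3)
    simp only [ContinuousLinearMap.comp_apply, smul_apply,
      ContinuousLinearMap.id_apply, map_smul, Complex.real_smul, smul_eq_mul] at h4
    refine mul_left_cancel₀ hs' (h4.trans ?_)
    ring
  simp only [dunklOperator, (hx.smul hs).reflectionQuotient_eq, hx.reflectionQuotient_eq, h1,
    map_smul, hm, inner_smul_right]
  rw [mul_add, mul_left_comm _ (1 / 2 : ℂ), Finset.mul_sum (a := (s : ℂ) ^ m)]
  congr 2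
  refine Finset.sum_congr rfl fun α _ => ?_
  have := hx.ne_zero α
  push_cast
  field_simp
  ring

/-- A homogeneous solution of the contracted eigenvalue equation solves the eigenvalue equation. -/
theorem IsRegular.dunklOperator_eq_of_contraction (hR : IsRootSystem R)
    (hμ : IsMultiplicityFunction R μ) (hμ0 : ∀ α, 0 ≤ μ α) {f h : RealSpace N → ℂ} {m : ℕ}
    (hf : ContDiff ℝ 2 f) (hh : Differentiable ℝ h)
    (hfm : ∀ (s : ℝ) x, f (s • x) = (s : ℂ) ^ (m + 1) * f x)
    (hhm : ∀ (s : ℝ) x, h (s • x) = (s : ℂ) ^ m * h x) (y : RealSpace N)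
    (heuler : ∀ x, ((m + 1 : ℕ) : ℂ) * f x +
      (1 / 2) * ∑ α : R, (μ α : ℂ) * (f x - f (rootReflection (α : RealSpace N) x)) =
        ((inner ℝ x y : ℝ) : ℂ) * h x)
    (hsymm : ∀ ξ η x, IsRegular R x → ((inner ℝ ξ y : ℝ) : ℂ) * dunklOperator μ η h x =
      ((inner ℝ η y : ℝ) : ℂ) * dunklOperator μ ξ h x)
    (ξ : RealSpace N) {x : RealSpace N} (hx : IsRegular R x) :
    dunklOperator μ ξ f x = ((inner ℝ ξ y : ℝ) : ℂ) * h x := by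
  have hf1 : Differentiable ℝ f := hf.differentiable two_ne_zero
  set F : RealSpace N → RealSpace N → ℂ :=
    fun ξ z => dunklOperator μ ξ f z - ((inner ℝ ξ y : ℝ) : ℂ) * h z with hF
  have hFadd : ∀ ξ η z, F (ξ + η) z = F ξ z + F η z := by
    intro ξ η z
    simp only [hF, dunklOperator_add, inner_add_left, Complex.ofReal_add]
    ring
  have hFsmul : ∀ (s : ℝ) ξ z, F (s • ξ) z = s * F ξ z := by
    intro s ξ z
    simp only [hF, dunklOperator_smul, inner_smul_left, conj_trivial, Complex.ofReal_mul]
    ring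
  have hFd : ∀ ξ z, IsRegular R z → DifferentiableAt ℝ (F ξ) z := fun ξ z hz =>
    (hz.hasFDerivAt_dunklOperator hf ξ).differentiableAt.sub ((hh z).const_mul _)
  have hF0 : ∀ z, IsRegular R z → F z z = 0 := by
    intro z hz
    simp only [hF]
    rw [hz.dunklOperator_self, ← heuler z, fderiv_apply_self_of_homogeneous (hf1 z)
      (fun s _ => hfm s z), sub_self]
  -- Differentiate `F_z(z) = 0` along `z + s η`, using linearity of `F` in its direction argument.
  have hA : ∀ η z, IsRegular R z → fderiv ℝ (F z) z η = -F η z := by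
    intro η z hz
    have hl : HasDerivAt (fun s : ℝ => z + s • η) η 0 := by
      simpa using ((hasDerivAt_id (0 : ℝ)).smul_const η).const_add z
    have hc : ∀ ζ, HasDerivAt (fun s : ℝ => F ζ (z + s • η)) (fderiv ℝ (F ζ) z η) 0 := fun ζ =>
      HasFDerivAt.comp_hasDerivAt (0 : ℝ) (by simpa using (hFd ζ z hz).hasFDerivAt) hl
    have h1 : HasDerivAt (fun s : ℝ => F z (z + s • η) + (s : ℂ) * F η (z + s • η))
        (fderiv ℝ (F z) z η + F η z) 0 := by
      have := (hc z).add ((Complex.ofRealCLM.hasDerivAt (x := (0 : ℝ))).mul (hc η))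
      simpa using! this
    have h2 : HasDerivAt (fun s : ℝ => F z (z + s • η) + (s : ℂ) * F η (z + s • η)) 0 0 := by
      refine (hasDerivAt_const (0 : ℝ) (0 : ℂ)).congr_of_eventuallyEq ?_
      have ht : Tendsto (fun s : ℝ => z + s • η) (𝓝 0) (𝓝 z) := by
        simpa using hl.continuousAt.tendsto
      filter_upwards [ht.eventually hz.eventually] with s hs
      rw [← hFsmul, ← hFadd, hF0 _ hs]
    exact eq_neg_of_add_eq_zero_left (h1.unique h2)
  -- Since `z = σ_α z + ⟨α, z⟩ α` and `F` vanishes when direction and point coincide, `F_z(σ_α z) =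
  -- ⟨α, z⟩ F_α(σ_α z)`.
  have hB : ∀ (α : R) z, IsRegular R z →
      reflectionQuotient (α : RealSpace N) (F z) z =
        -F α (rootReflection (α : RealSpace N) z) := by
    intro α z hz
    have h1 : F z (rootReflection (α : RealSpace N) z) =
        ((inner ℝ (α : RealSpace N) z : ℝ) : ℂ) * F α (rootReflection (α : RealSpace N) z) := by
      have : z = rootReflection (α : RealSpace N) z +
          inner ℝ (α : RealSpace N) z • (α : RealSpace N) := by
        rw [hR.reflection_apply]; abel
      refine (congrArg (F · (rootReflection (α : RealSpace N) z)) this).trans ?_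
      simp only [hFadd, hFsmul, hF0 _ (hz.reflection hR α), zero_add]
    rw [hz.reflectionQuotient_eq, hF0 z hz, h1, zero_sub, neg_div,
      mul_div_cancel_left₀ _ (hz.ne_zero α)]
  -- Commutativity of Dunkl operators handles the `f` part of `F`; the compatibility hypothesis
  -- `hsymm` handles the `h` part.
  have hC : ∀ η z, IsRegular R z → dunklOperator μ η (F z) z = dunklOperator μ z (F η) z := by
    intro η z hz
    have h1 : ∀ ζ, DifferentiableAt ℝ (dunklOperator μ ζ f) z := fun ζ =>
      (hz.hasFDerivAt_dunklOperator hf ζ).differentiableAt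
    simp only [hF]
    rw [hz.dunklOperator_sub_const_mul (h1 _) (hh z), hz.dunklOperator_sub_const_mul (h1 _) (hh z),
      hz.dunklOperator_comm hR hμ hf, hsymm z η z hz]
  have hhom : ∀ η z, IsRegular R z → fderiv ℝ (F η) z z = m * F η z := by
    intro η z hz
    refine fderiv_apply_self_of_homogeneous (hFd η z hz) fun s hs => ?_
    simp only [hF]
    rw [dunklOperator_smul_point hf1 hfm η hz hs.ne', hhm]
    ring
  -- In `hC` the right side contributes `m F_η` by homogeneity and the left side `-F_η` by `hA`,
  -- whence the factor `m + 1`. The terms from `hB` turn `F_η(σ_α z)` into `F_{σ_α η}(σ_α z)`.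
  have key : ∀ η z, IsRegular R z → ((m + 1 : ℕ) : ℝ) • F η z + ∑ α : R, (μ α / 2) •
      (F η z - F (rootReflection (α : RealSpace N) η) (rootReflection (α : RealSpace N) z)) =
        0 := by
    intro η z hz
    have h1 := hC η z hz
    rw [hz.dunklOperator_self, hhom η z hz, dunklOperator, hA η z hz] at h1
    simp only [hB _ z hz] at h1
    have h2 : ∀ α : R, F (rootReflection (α : RealSpace N) η) (rootReflection (α : RealSpace N) z) =
        F η (rootReflection (α : RealSpace N) z) - ((inner ℝ (α : RealSpace N) η : ℝ) : ℂ) *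
          F α (rootReflection (α : RealSpace N) z) := by
      intro α
      rw [hR.reflection_apply α η, sub_eq_add_neg, ← neg_smul, hFadd, hFsmul]
      push_cast
      ring
    rw [eq_comm, ← sub_eq_zero] at h1
    rw [← h1]
    simp only [h2, Complex.real_smul, Finset.mul_sum]
    rw [add_sub_add_comm, ← Finset.sum_sub_distrib]
    congr 1
    · push_cast; ring
    · refine Finset.sum_congr rfl fun α _ => ?_
      push_cast
      ring
  have := hR.finite_coxeterGroup
  -- The maximum principle is applied to `g ↦ F_{gξ}(g x)`, with direction and point moved together,
  -- and read at `g = 1`.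
  have h0 := eq_zero_of_mul_add_sum_sub_eq_zero (G := coxeterGroup R) (k := fun α : R => μ α / 2)
    (fun α g => groupReflection α * g) (fun α => div_nonneg (hμ0 α) zero_le_two)
    (r := ((m + 1 : ℕ) : ℝ)) (by positivity)
    (fun g => F ((g : RealSpace N ≃ₗᵢ[ℝ] RealSpace N) ξ) ((g : RealSpace N ≃ₗᵢ[ℝ] RealSpace N) x))
    (fun g => key _ _ (hx.map hR g)) 1
  exact sub_eq_zero.1 h0

end Operators

/-! ### Extension from regular points to the reflecting hyperplanes -/

section Walls

open Filter Topology

variable {N : ℕ} {R : Finset (RealSpace N)} {μ : R → ℝ}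

theorem IsRootSystem.dense_isRegular (hR : IsRootSystem R) : Dense {x | IsRegular R x} := by
  simp only [IsRegular, Set.ofPred_forall]
  refine dense_biInter_of_isOpen (S := {α | α ∈ R}) (fun α _ =>
    isOpen_ne_fun (continuous_const.inner continuous_id) continuous_const)
    R.finite_toSet.countable fun α hα => ?_
  have h : {x : RealSpace N | inner ℝ α x ≠ 0} =
      ((LinearMap.ker (innerSL ℝ α).toLinearMap : Submodule ℝ (RealSpace N)) :
        Set (RealSpace N))ᶜ := by
    ext x
    simp
  rw [h, ← interior_eq_empty_iff_dense_compl, ← Set.not_nonempty_iff_eq_empty]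
  intro hne
  have htop := Submodule.eq_top_of_nonempty_interior' _ hne
  have : α ∈ LinearMap.ker (innerSL ℝ α).toLinearMap := htop ▸ Submodule.mem_top
  exact hR.ne_zero α hα (by simpa using this)

/-- At a point of the hyperplane of `α`, both `z` and `σ_α z` tend to `x` and `z - σ_α z = ⟨α, z⟩
α`, so strict differentiability of `f` gives the limit `∂_α f(x)`. This is the assigned value, as
`2/‖α‖² = 1`. -/
theorem IsRootSystem.tendsto_reflectionQuotient (hR : IsRootSystem R) (α : R)
    {f : RealSpace N → ℂ} (hf : ContDiff ℝ 1 f) (x : RealSpace N) :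
    Tendsto (reflectionQuotient (α : RealSpace N) f) (𝓝[{x | IsRegular R x}] x)
      (𝓝 (reflectionQuotient (α : RealSpace N) f x)) := by
  have hσ : Continuous fun z : RealSpace N => rootReflection (α : RealSpace N) z :=
    (rootReflection (α : RealSpace N)).continuous
  have hα : Continuous fun z : RealSpace N => ((inner ℝ (α : RealSpace N) z : ℝ) : ℂ) :=
    Complex.continuous_ofReal.comp (continuous_const.inner continuous_id)
  have heq : reflectionQuotient (α : RealSpace N) f =ᶠ[𝓝[{x | IsRegular R x}] x]
      fun z => (f z - f (rootReflection (α : RealSpace N) z)) /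
        ((inner ℝ (α : RealSpace N) z : ℝ) : ℂ) := by
    filter_upwards [self_mem_nhdsWithin] with z hz
    exact hz.reflectionQuotient_eq α f
  refine Tendsto.congr' heq.symm ?_
  by_cases h : inner ℝ (α : RealSpace N) x = 0
  · have hx : rootReflection (α : RealSpace N) x = x := by
      rw [hR.reflection_apply, h, zero_smul, sub_zero]
    have hs : HasStrictFDerivAt f (fderiv ℝ f x) x :=
      hf.contDiffAt.hasStrictFDerivAt one_ne_zero
    have ht : Tendsto (fun z => (z, rootReflection (α : RealSpace N) z)) (𝓝 x) (𝓝 (x, x)) := by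
      have := (continuous_id.prodMk hσ).tendsto x
      rwa [id, hx] at this
    have h1 := hs.isLittleO.comp_tendsto (ht.mono_left
      (nhdsWithin_le_nhds (s := {x | IsRegular R x})))
    have h2 : (fun z => z - rootReflection (α : RealSpace N) z)
        =O[𝓝[{x | IsRegular R x}] x] fun z => ((inner ℝ (α : RealSpace N) z : ℝ) : ℂ) := by
      refine Asymptotics.IsBigO.of_bound ‖(α : RealSpace N)‖ (Eventually.of_forall fun z => ?_)
      rw [hR.reflection_apply, sub_sub_cancel, norm_smul, Complex.norm_real, mul_comm]
    have h3 := (h1.trans_isBigO h2).tendsto_div_nhds_zero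
    have h4 : reflectionQuotient (α : RealSpace N) f x = fderiv ℝ f x α := by
      rw [reflectionQuotient, if_pos h, hR.norm_sq α α.2]
      simp
    rw [h4, ← zero_add (fderiv ℝ f x α)]
    refine (h3.add_const (fderiv ℝ f x α)).congr' ?_
    filter_upwards [self_mem_nhdsWithin] with z hz
    have hz' := IsRegular.ne_zero hz α
    have h5 : fderiv ℝ f x (z - rootReflection (α : RealSpace N) z) =
        ((inner ℝ (α : RealSpace N) z : ℝ) : ℂ) * fderiv ℝ f x α := by
      rw [hR.reflection_apply, sub_sub_cancel, map_smul, Complex.real_smul]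
    simp only [Function.comp_apply, h5]
    field_simp
    ring
  · rw [reflectionQuotient, if_neg h]
    refine Tendsto.mono_left ?_ nhdsWithin_le_nhds
    exact ((hf.continuous.sub (hf.continuous.comp hσ)).tendsto x).div (hα.tendsto x)
      (Complex.ofReal_ne_zero.2 h)

theorem IsRootSystem.tendsto_dunklOperator (hR : IsRootSystem R)
    {f : RealSpace N → ℂ} (hf : ContDiff ℝ 1 f) (ξ x : RealSpace N) :
    Tendsto (dunklOperator μ ξ f) (𝓝[{x | IsRegular R x}] x) (𝓝 (dunklOperator μ ξ f x)) := by
  refine Tendsto.add ?_ (Tendsto.const_mul _ (tendsto_finsetSum _ fun α _ =>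
    Tendsto.const_mul _ (hR.tendsto_reflectionQuotient α hf x)))
  exact (((hf.continuous_fderiv one_ne_zero).clm_apply continuous_const).tendsto x).mono_left
    nhdsWithin_le_nhds

theorem IsRootSystem.dunklOperator_eq_of_regular (hR : IsRootSystem R)
    {f h : RealSpace N → ℂ} (hf : ContDiff ℝ 1 f) (hh : Continuous h) (ξ : RealSpace N)
    (H : ∀ x, IsRegular R x → dunklOperator μ ξ f x = h x) (x : RealSpace N) :
    dunklOperator μ ξ f x = h x := by
  have : (𝓝[{x | IsRegular R x}] x).NeBot :=
    mem_closure_iff_nhdsWithin_neBot.1 (hR.dense_isRegular x)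
  refine tendsto_nhds_unique (hR.tendsto_dunklOperator hf ξ x)
    (((hh.tendsto x).mono_left nhdsWithin_le_nhds).congr' ?_)
  filter_upwards [self_mem_nhdsWithin] with z hz using (H z hz).symm

end Walls

/-! ### Complexification -/

section Complexification

variable {N : ℕ}

/-- The inclusion `ℝ^N → ℂ^N` as a continuous real linear map. -/
def toComplexL (N : ℕ) : RealSpace N →L[ℝ] ComplexSpace N :=
  LinearMap.toContinuousLinearMap
    { toFun := toComplex
      map_add' := fun x y => by ext j; simp [toComplex]
      map_smul' := fun r x => by ext j; simp [toComplex] }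

@[simp]
theorem toComplexL_apply (x : RealSpace N) : toComplexL N x = toComplex x := rfl

@[simp]
theorem toComplex_zero : toComplex (0 : RealSpace N) = 0 := map_zero (toComplexL N)

theorem toComplex_smul (r : ℝ) (x : RealSpace N) :
    toComplex (r • x) = (r : ℂ) • toComplex x :=
  (map_smul (toComplexL N) r x).trans (Complex.coe_smul r _).symm

theorem exists_eq_toComplex_add (z : ComplexSpace N) :
    ∃ a b : RealSpace N, z = toComplex a + Complex.I • toComplex b := by
  refine ⟨WithLp.toLp 2 fun j => (z j).re, WithLp.toLp 2 fun j => (z j).im, ?_⟩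
  ext j
  simp [toComplex, mul_comm Complex.I]

theorem norm_sq_toComplex_add (a b : RealSpace N) :
    ‖toComplex a + Complex.I • toComplex b‖ ^ 2 = ‖a‖ ^ 2 + ‖b‖ ^ 2 := by
  rw [EuclideanSpace.norm_sq_eq, EuclideanSpace.norm_sq_eq, EuclideanSpace.norm_sq_eq,
    ← Finset.sum_add_distrib]
  refine Finset.sum_congr rfl fun j _ => ?_
  rw [Complex.sq_norm, Complex.normSq_apply]
  simp [toComplex, sq]

/-- The complex linear extension to `ℂ^N` of an isometry of `ℝ^N`. -/
def complexify (g : RealSpace N ≃ₗᵢ[ℝ] RealSpace N) : ComplexSpace N →L[ℂ] ComplexSpace N :=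
  ∑ j, (EuclideanSpace.proj j : ComplexSpace N →L[ℂ] ℂ).smulRight
    (toComplex (g (EuclideanSpace.single j 1)))

@[simp]
theorem complexify_toComplex (g : RealSpace N ≃ₗᵢ[ℝ] RealSpace N) (x : RealSpace N) :
    complexify g (toComplex x) = toComplex (g x) := by
  have hx : x = ∑ j, x j • EuclideanSpace.single j (1 : ℝ) := by
    conv_lhs => rw [← (EuclideanSpace.basisFun (Fin N) ℝ).sum_repr x]
    simp
  conv_rhs => rw [hx, ← toComplexL_apply, map_sum, map_sum]
  simp only [complexify, sum_apply, ContinuousLinearMap.smulRight_apply,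
    map_smul, toComplexL_apply]
  rfl

/-- The extension acts on real and imaginary parts separately, and their squared norms add. This
keeps the bounds on the kernel components invariant under the group. -/
theorem norm_complexify (g : RealSpace N ≃ₗᵢ[ℝ] RealSpace N) (z : ComplexSpace N) :
    ‖complexify g z‖ = ‖z‖ := by
  obtain ⟨a, b, rfl⟩ := exists_eq_toComplex_add z
  rw [← sq_eq_sq₀ (norm_nonneg _) (norm_nonneg _), map_add, map_smul, complexify_toComplex,
    complexify_toComplex, norm_sq_toComplex_add, norm_sq_toComplex_add, g.norm_map, g.norm_map]

/-- The bilinear pairing `∑ j, z_j w_j` on `ℂ^N`. -/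
def pairing (p : ComplexSpace N × ComplexSpace N) : ℂ := ∑ j, p.1 j * p.2 j

theorem pairing_toComplex (x y : RealSpace N) :
    pairing (toComplex x, toComplex y) = ((inner ℝ x y : ℝ) : ℂ) := by
  simp [pairing, toComplex, PiLp.inner_apply, mul_comm]

theorem bilinSq_toComplex (x : RealSpace N) : bilinSq (toComplex x) = ((‖x‖ ^ 2 : ℝ) : ℂ) := by
  simp [bilinSq, toComplex, EuclideanSpace.norm_sq_eq]

theorem norm_pairing_le (p : ComplexSpace N × ComplexSpace N) :
    ‖pairing p‖ ≤ ‖p.1‖ * ‖p.2‖ := by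
  calc ‖pairing p‖ ≤ ∑ j, ‖p.1 j‖ * ‖p.2 j‖ := by
        refine (norm_sum_le _ _).trans_eq (Finset.sum_congr rfl fun j _ => norm_mul _ _)
    _ ≤ √(∑ j, ‖p.1 j‖ ^ 2) * √(∑ j, ‖p.2 j‖ ^ 2) := Real.sum_mul_le_sqrt_mul_sqrt _ _ _
    _ = ‖p.1‖ * ‖p.2‖ := by rw [EuclideanSpace.norm_eq, EuclideanSpace.norm_eq]

theorem contDiff_pairing {n : WithTop ℕ∞} :
    ContDiff ℂ n (pairing : ComplexSpace N × ComplexSpace N → ℂ) := by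
  unfold pairing
  refine ContDiff.sum fun j _ => ContDiff.mul ?_ ?_
  · exact ((EuclideanSpace.proj j : ComplexSpace N →L[ℂ] ℂ).contDiff).comp contDiff_fst
  · exact ((EuclideanSpace.proj j : ComplexSpace N →L[ℂ] ℂ).contDiff).comp contDiff_snd

theorem contDiff_bilinSq {n : WithTop ℕ∞} :
    ContDiff ℂ n (bilinSq : ComplexSpace N → ℂ) := by
  unfold bilinSq
  exact ContDiff.sum fun j _ =>
    ((EuclideanSpace.proj j : ComplexSpace N →L[ℂ] ℂ).contDiff).pow 2

end Complexification

/-! ### Two facts on holomorphic functions of several variables -/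

section Holomorphic

open Filter Topology

/-- Cauchy's estimate on the complex line `s ↦ x + s v`, with the circle of radius `1/‖v‖`, whose
image lies in the unit ball around `x`. -/
theorem norm_fderiv_le_of_norm_le {E F : Type*} [NormedAddCommGroup E] [NormedSpace ℂ E]
    [NormedAddCommGroup F] [NormedSpace ℂ F] {f : E → F}
    (hf : Differentiable ℂ f) {x : E} {C : ℝ} (hC : ∀ z ∈ Metric.closedBall x 1, ‖f z‖ ≤ C) :
    ‖fderiv ℂ f x‖ ≤ C := by
  have hC0 : 0 ≤ C := (norm_nonneg _).trans (hC x (Metric.mem_closedBall_self zero_le_one))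
  refine ContinuousLinearMap.opNorm_le_bound _ hC0 fun v => ?_
  by_cases hv : v = 0
  · simp [hv]
  have hv' : 0 < ‖v‖ := norm_pos_iff.2 hv
  have hl : ∀ s : ℂ, HasDerivAt (fun s : ℂ => x + s • v) v s := fun s => by
    simpa using ((hasDerivAt_id s).smul_const v).const_add x
  have hd : ∀ s : ℂ, HasDerivAt (fun s : ℂ => f (x + s • v)) (fderiv ℂ f (x + s • v) v) s :=
    fun s => (hf _).hasFDerivAt.comp_hasDerivAt s (hl s)
  have h := Complex.norm_deriv_le_of_forall_mem_sphere_norm_le (c := 0) (inv_pos.2 hv')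
    (f := fun s : ℂ => f (x + s • v)) (C := C)
    (Differentiable.diffContOnCl fun s => (hd s).differentiableAt) fun s hs => hC _ ?_
  · rw [(hd 0).deriv, zero_smul, add_zero, div_inv_eq_mul] at h
    exact h
  · rw [mem_sphere_zero_iff_norm] at hs
    rw [Metric.mem_closedBall, dist_self_add_left, norm_smul, hs, inv_mul_cancel₀ hv'.ne']

/-- Any complex point is the value at `s = i` of a complex line with real coefficients. On this line
the functions agree for real `s`, so the one-variable identity theorem applies. -/
theorem eq_of_eq_on_real {N : ℕ} {F H : ComplexSpace N → ComplexSpace N → ℂ}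
    (hF : IsHolomorphic F) (hH : IsHolomorphic H)
    (h : ∀ x y : RealSpace N, F (toComplex x) (toComplex y) = H (toComplex x) (toComplex y)) :
    F = H := by
  ext z w
  obtain ⟨a, b, rfl⟩ := exists_eq_toComplex_add z
  obtain ⟨c, d, rfl⟩ := exists_eq_toComplex_add w
  have hl : Differentiable ℂ fun s : ℂ =>
      ((toComplex a + s • toComplex b, toComplex c + s • toComplex d) :
        ComplexSpace N × ComplexSpace N) := by
    fun_prop
  have h1 : AnalyticOnNhd ℂ (fun s : ℂ => F (toComplex a + s • toComplex b)
      (toComplex c + s • toComplex d)) Set.univ :=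
    fun s _ => (hF.comp hl).analyticAt s
  have h2 : AnalyticOnNhd ℂ (fun s : ℂ => H (toComplex a + s • toComplex b)
      (toComplex c + s • toComplex d)) Set.univ :=
    fun s _ => (hH.comp hl).analyticAt s
  have hreal : ∀ s : ℝ, F (toComplex a + (s : ℂ) • toComplex b)
      (toComplex c + (s : ℂ) • toComplex d) = H (toComplex a + (s : ℂ) • toComplex b)
      (toComplex c + (s : ℂ) • toComplex d) := by
    intro s
    have e : ∀ u v : RealSpace N, toComplex u + (s : ℂ) • toComplex v = toComplex (u + s • v) := by
      intro u v
      rw [← toComplex_smul]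
      exact (map_add (toComplexL N) _ _).symm
    rw [e, e, h]
  refine congrFun (h1.eq_of_frequently_eq (z₀ := 0) h2 ?_) Complex.I
  have ht : Tendsto (fun s : ℝ => (s : ℂ)) (𝓝[≠] 0) (𝓝[≠] 0) := by
    refine tendsto_nhdsWithin_iff.2 ⟨?_, ?_⟩
    · exact (Complex.continuous_ofReal.tendsto' 0 0 Complex.ofReal_zero).mono_left
        nhdsWithin_le_nhds
    · filter_upwards [self_mem_nhdsWithin] with s hs using Complex.ofReal_ne_zero.2 hs
  exact ht.frequently (Frequently.of_forall hreal)

end Holomorphic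

/-! ### The homogeneous components of the Dunkl kernel -/

section Terms

variable {N : ℕ} {R : Finset (RealSpace N)} {μ : R → ℝ} [Fintype (coxeterGroup R)]

/-- The `n`-th homogeneous component of the Dunkl kernel, obtained by repeated averaging over the
reflection group with the weights `c n`. -/
def kernelTerm (c : ℕ → coxeterGroup R → ℝ) : ℕ → ComplexSpace N × ComplexSpace N → ℂ
  | 0, _ => 1
  | n + 1, p => ∑ g : coxeterGroup R, (c n g : ℂ) *
      (pairing (complexify (g : RealSpace N ≃ₗᵢ[ℝ] RealSpace N) p.1, p.2) *
        kernelTerm c n (complexify (g : RealSpace N ≃ₗᵢ[ℝ] RealSpace N) p.1, p.2))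

variable {c : ℕ → coxeterGroup R → ℝ}

theorem contDiff_kernelTerm (c : ℕ → coxeterGroup R → ℝ) {k : WithTop ℕ∞} (n : ℕ) :
    ContDiff ℂ k (kernelTerm c n) := by
  induction n with
  | zero => exact contDiff_const
  | succ n ih =>
    refine ContDiff.sum fun g _ => contDiff_const.mul ?_
    have hg : ContDiff ℂ k fun p : ComplexSpace N × ComplexSpace N =>
        (complexify (g : RealSpace N ≃ₗᵢ[ℝ] RealSpace N) p.1, p.2) :=
      ((ContinuousLinearMap.contDiff _).comp contDiff_fst).prodMk contDiff_snd
    exact (contDiff_pairing.comp hg).mul (ih.comp hg)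

/-- Because the weights are nonnegative with mass `1/(n+1)` and the group preserves the norm, each
step multiplies the bound by `‖p.1‖‖p.2‖/(n+1)`. -/
theorem norm_kernelTerm_le (hc0 : ∀ n g, 0 ≤ c n g) (hc1 : ∀ n, ∑ g, c n g = 1 / ((n + 1 : ℕ) : ℝ))
    (n : ℕ) (p : ComplexSpace N × ComplexSpace N) :
    ‖kernelTerm c n p‖ ≤ (‖p.1‖ * ‖p.2‖) ^ n / n.factorial := by
  induction n generalizing p with
  | zero => simp [kernelTerm]
  | succ n ih =>
    calc ‖kernelTerm c (n + 1) p‖ ≤ ∑ g : coxeterGroup R, c n g *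
          ((‖p.1‖ * ‖p.2‖) * ((‖p.1‖ * ‖p.2‖) ^ n / n.factorial)) := by
          refine (norm_sum_le _ _).trans (Finset.sum_le_sum fun g _ => ?_)
          rw [norm_mul, norm_mul, Complex.norm_real, Real.norm_of_nonneg (hc0 n g)]
          refine mul_le_mul_of_nonneg_left ?_ (hc0 n g)
          refine mul_le_mul ((norm_pairing_le _).trans_eq ?_) ((ih _).trans_eq ?_)
            (norm_nonneg _) (by positivity)
          · simp only [norm_complexify]
          · simp only [norm_complexify]
      _ = (‖p.1‖ * ‖p.2‖) ^ (n + 1) / (n + 1).factorial := by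
          rw [← Finset.sum_mul, hc1, Nat.factorial_succ, pow_succ]
          push_cast
          field_simp

theorem kernelTerm_smul (c : ℕ → coxeterGroup R → ℝ) (n : ℕ) (s : ℂ) (z w : ComplexSpace N) :
    kernelTerm c n (s • z, w) = s ^ n * kernelTerm c n (z, w) := by
  induction n generalizing z with
  | zero => simp [kernelTerm]
  | succ n ih =>
    simp only [kernelTerm, map_smul, ih, Finset.mul_sum]
    refine Finset.sum_congr rfl fun g _ => ?_
    have : ∀ v : ComplexSpace N, pairing (s • v, w) = s * pairing (v, w) := fun v => by
      simp [pairing, Finset.mul_sum, mul_assoc]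
    rw [this]
    ring

theorem im_kernelTerm (c : ℕ → coxeterGroup R → ℝ) (n : ℕ) (x y : RealSpace N) :
    (kernelTerm c n (toComplex x, toComplex y)).im = 0 := by
  induction n generalizing x with
  | zero => simp [kernelTerm]
  | succ n ih =>
    simp only [kernelTerm, complexify_toComplex, pairing_toComplex, Complex.im_sum]
    refine Finset.sum_eq_zero fun g _ => ?_
    rw [Complex.im_ofReal_mul, Complex.im_ofReal_mul, ih, mul_zero, mul_zero]

/-- Replacing `x` by `σ_α x` amounts, after reindexing the group, to right translation of the
weights by `σ_α`. The hypothesis `hc` says that the weights are the Green function with source at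
the identity, so only the term `g = 1` survives. -/
theorem kernelTerm_euler [DecidableEq (coxeterGroup R)]
    (hc : ∀ n g, ((n + 1 : ℕ) : ℝ) * c n g +
      ∑ α : R, μ α / 2 * (c n g - c n (g * groupReflection α)) = if g = 1 then 1 else 0)
    (n : ℕ) (x y : RealSpace N) :
    ((n + 1 : ℕ) : ℂ) * kernelTerm c (n + 1) (toComplex x, toComplex y) +
      (1 / 2) * ∑ α : R, (μ α : ℂ) * (kernelTerm c (n + 1) (toComplex x, toComplex y) -
        kernelTerm c (n + 1) (toComplex (rootReflection (α : RealSpace N) x), toComplex y)) =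
      ((inner ℝ x y : ℝ) : ℂ) * kernelTerm c n (toComplex x, toComplex y) := by
  set φ : coxeterGroup R → ℂ := fun g =>
    ((inner ℝ ((g : RealSpace N ≃ₗᵢ[ℝ] RealSpace N) x) y : ℝ) : ℂ) *
      kernelTerm c n (toComplex ((g : RealSpace N ≃ₗᵢ[ℝ] RealSpace N) x), toComplex y) with hφ
  have h1 : kernelTerm c (n + 1) (toComplex x, toComplex y) = ∑ g, (c n g : ℂ) * φ g := by
    simp only [kernelTerm, complexify_toComplex, pairing_toComplex, hφ]
  have h2 : ∀ α : R, kernelTerm c (n + 1) (toComplex (rootReflection (α : RealSpace N) x),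
      toComplex y) = ∑ g, (c n (g * groupReflection α) : ℂ) * φ g := by
    intro α
    rw [← Equiv.sum_comp (Equiv.mulRight (groupReflection α))]
    simp only [kernelTerm, complexify_toComplex, pairing_toComplex, hφ, Equiv.coe_mulRight]
    have h : groupReflection α * groupReflection α = 1 := by
      ext1
      exact Submodule.reflection_mul_reflection _
    simp only [mul_assoc, h, mul_one]
    rfl
  have h3 : ∀ g, (((n + 1 : ℕ) : ℂ) * (c n g : ℂ) + ∑ α : R, (μ α : ℂ) / 2 *
      ((c n g : ℂ) - (c n (g * groupReflection α) : ℂ))) * φ g = if g = 1 then φ g else 0 := by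
    intro g
    have := congrArg (fun r : ℝ => (r : ℂ) * φ g) (hc n g)
    push_cast at this ⊢
    rw [this]
    split_ifs <;> simp
  calc _ = ∑ g, (((n + 1 : ℕ) : ℂ) * (c n g : ℂ) + ∑ α : R, (μ α : ℂ) / 2 *
      ((c n g : ℂ) - (c n (g * groupReflection α) : ℂ))) * φ g := by
        simp only [add_mul, Finset.sum_add_distrib, Finset.sum_mul]
        rw [Finset.sum_comm, h1, Finset.mul_sum, Finset.mul_sum]
        congr 1
        · exact Finset.sum_congr rfl fun g _ => by ring
        · refine Finset.sum_congr rfl fun α _ => ?_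
          rw [h2, ← Finset.sum_sub_distrib, Finset.mul_sum, Finset.mul_sum]
          exact Finset.sum_congr rfl fun g _ => by ring
    _ = φ 1 := by
        simp only [h3, Finset.sum_ite_eq', Finset.mem_univ, if_true]

theorem contDiff_kernelTerm_real (c : ℕ → coxeterGroup R → ℝ) {k : WithTop ℕ∞} (n : ℕ)
    (y : RealSpace N) :
    ContDiff ℝ k fun x : RealSpace N => kernelTerm c n (toComplex x, toComplex y) :=
  ((contDiff_kernelTerm c n).restrict_scalars ℝ).comp
    ((toComplexL N).contDiff.prodMk contDiff_const)

theorem dunklOperator_kernelTerm [DecidableEq (coxeterGroup R)] (hR : IsRootSystem R)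
    (hμ : IsMultiplicityFunction R μ)    (hμ0 : ∀ α, 0 ≤ μ α)
    (hc : ∀ n g, ((n + 1 : ℕ) : ℝ) * c n g +
      ∑ α : R, μ α / 2 * (c n g - c n (g * groupReflection α)) = if g = 1 then 1 else 0)
    (n : ℕ) (y ξ x : RealSpace N) :
    dunklOperator μ ξ (fun x => kernelTerm c (n + 1) (toComplex x, toComplex y)) x =
      ((inner ℝ ξ y : ℝ) : ℂ) * kernelTerm c n (toComplex x, toComplex y) := by
  have hhom : ∀ (m : ℕ) (s : ℝ) (x : RealSpace N),
      kernelTerm c m (toComplex (s • x), toComplex y) =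
        (s : ℂ) ^ m * kernelTerm c m (toComplex x, toComplex y) := fun m s x => by
    rw [toComplex_smul, kernelTerm_smul]
  have hdiff : ∀ m, Differentiable ℝ fun x : RealSpace N =>
      kernelTerm c m (toComplex x, toComplex y) := fun m =>
    (contDiff_kernelTerm_real c (k := 1) m y).differentiable one_ne_zero
  induction n generalizing ξ x with
  | zero =>
    refine hR.dunklOperator_eq_of_regular (contDiff_kernelTerm_real c 1 y)
      ((hdiff 0).continuous.const_mul _) ξ (fun x hx => ?_) x
    refine hx.dunklOperator_eq_of_contraction hR hμ hμ0 (contDiff_kernelTerm_real c 1 y)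
      -- For degree zero the compatibility condition is trivial, as Dunkl operators kill constants.
      (hdiff 0) (hhom 1) (hhom 0) y (fun x => kernelTerm_euler hc 0 x y) (fun ξ η x _ => ?_) ξ
    simp only [kernelTerm, dunklOperator_const, mul_zero]
  | succ n ih =>
    refine hR.dunklOperator_eq_of_regular (contDiff_kernelTerm_real c (n + 2) y)
      ((hdiff (n + 1)).continuous.const_mul _) ξ (fun x hx => ?_) x
    refine hx.dunklOperator_eq_of_contraction hR hμ hμ0 (contDiff_kernelTerm_real c (n + 2) y)
      (hdiff (n + 1)) (hhom (n + 2)) (hhom (n + 1)) y (fun x => kernelTerm_euler hc (n + 1) x y)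
      (fun ξ η x _ => ?_) ξ
    -- By induction both sides become `⟨ξ, y⟩⟨η, y⟩` times the component of degree `n`.
    rw [ih, ih]
    ring

/-! ### The Dunkl kernel -/

theorem summable_kernelTerm (hc0 : ∀ n g, 0 ≤ c n g)
    (hc1 : ∀ n, ∑ g, c n g = 1 / ((n + 1 : ℕ) : ℝ)) (p : ComplexSpace N × ComplexSpace N) :
    Summable fun n => kernelTerm c n p :=
  Summable.of_norm_bounded (Real.summable_pow_div_factorial _) (norm_kernelTerm_le hc0 hc1 · p)

/-- Passing to the unit ball around `p` enlarges the radius to `r + 1`. The bound is uniform on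
bounded sets and summable, which permits termwise differentiation of the series. -/
theorem norm_fderiv_kernelTerm_le (hc0 : ∀ n g, 0 ≤ c n g)
    (hc1 : ∀ n, ∑ g, c n g = 1 / ((n + 1 : ℕ) : ℝ)) (n : ℕ)
    {p : ComplexSpace N × ComplexSpace N} {r : ℝ} (hp : ‖p‖ ≤ r) :
    ‖fderiv ℂ (kernelTerm c n) p‖ ≤ ((r + 1) * (r + 1)) ^ n / n.factorial := by
  refine norm_fderiv_le_of_norm_le
    ((contDiff_kernelTerm c (k := 1) n).differentiable one_ne_zero) fun q hq => ?_
  have hq' : ‖q‖ ≤ r + 1 := by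
    have h1 : ‖q - p‖ ≤ 1 := mem_closedBall_iff_norm.1 hq
    calc ‖q‖ = ‖p + (q - p)‖ := by rw [add_sub_cancel]
      _ ≤ r + 1 := (norm_add_le _ _).trans (add_le_add hp h1)
  refine (norm_kernelTerm_le hc0 hc1 n q).trans ?_
  have h1 := (norm_fst_le q).trans hq'
  have h2 := (norm_snd_le q).trans hq'
  have h0 : 0 ≤ r + 1 := (norm_nonneg _).trans hq'
  gcongr

theorem summable_fderiv_kernelTerm (hc0 : ∀ n g, 0 ≤ c n g)
    (hc1 : ∀ n, ∑ g, c n g = 1 / ((n + 1 : ℕ) : ℝ)) (p : ComplexSpace N × ComplexSpace N) :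
    Summable fun n => fderiv ℂ (kernelTerm c n) p :=
  Summable.of_norm_bounded (Real.summable_pow_div_factorial _)
    (norm_fderiv_kernelTerm_le hc0 hc1 · le_rfl)

theorem hasFDerivAt_tsum_kernelTerm (hc0 : ∀ n g, 0 ≤ c n g)
    (hc1 : ∀ n, ∑ g, c n g = 1 / ((n + 1 : ℕ) : ℝ)) (p : ComplexSpace N × ComplexSpace N) :
    HasFDerivAt (fun p => ∑' n, kernelTerm c n p) (∑' n, fderiv ℂ (kernelTerm c n) p) p := by
  have hp : p ∈ Metric.ball (0 : ComplexSpace N × ComplexSpace N) (‖p‖ + 1) := by simp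
  exact hasFDerivAt_tsum_of_isPreconnected
    (Real.summable_pow_div_factorial ((‖p‖ + 1 + 1) * (‖p‖ + 1 + 1))) Metric.isOpen_ball
    (convex_ball _ _).isPreconnected
    (fun n q _ => ((contDiff_kernelTerm c (k := 1) n).differentiable one_ne_zero q).hasFDerivAt)
    (fun n q hq => norm_fderiv_kernelTerm_le hc0 hc1 n (mem_ball_zero_iff.1 hq).le) hp
    (summable_kernelTerm hc0 hc1 p) hp

theorem hasSum_dunklOperator_kernelTerm (hc0 : ∀ n g, 0 ≤ c n g)
    (hc1 : ∀ n, ∑ g, c n g = 1 / ((n + 1 : ℕ) : ℝ)) (ξ x y : RealSpace N) :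
    HasSum (fun n => dunklOperator μ ξ (fun x => kernelTerm c n (toComplex x, toComplex y)) x)
      (dunklOperator μ ξ (fun x => ∑' n, kernelTerm c n (toComplex x, toComplex y)) x) := by
  have hl : HasFDerivAt (fun x : RealSpace N => (toComplex x, toComplex y))
      ((toComplexL N).prod 0) x :=
    (toComplexL N).hasFDerivAt.prodMk (hasFDerivAt_const _ _)
  have hd : ∀ v, HasSum
      (fun n => fderiv ℝ (fun x => kernelTerm c n (toComplex x, toComplex y)) x v)
      (fderiv ℝ (fun x => ∑' n, kernelTerm c n (toComplex x, toComplex y)) x v) := by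
    intro v
    have h1 : fderiv ℝ (fun x => ∑' n, kernelTerm c n (toComplex x, toComplex y)) x v =
        (∑' n, fderiv ℂ (kernelTerm c n) (toComplex x, toComplex y)) (toComplex v, 0) := by
      have := ((hasFDerivAt_tsum_kernelTerm hc0 hc1
        (toComplex x, toComplex y)).restrictScalars ℝ).comp x hl
      exact congrArg (fun A => A v) (HasFDerivAt.fderiv this)
    have h2 : ∀ n, fderiv ℝ (fun x => kernelTerm c n (toComplex x, toComplex y)) x v =
        fderiv ℂ (kernelTerm c n) (toComplex x, toComplex y) (toComplex v, 0) := by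
      intro n
      have := ((((contDiff_kernelTerm c (k := 1) n).differentiable one_ne_zero
        (toComplex x, toComplex y)).hasFDerivAt).restrictScalars ℝ).comp x hl
      exact congrArg (fun A => A v) (HasFDerivAt.fderiv this)
    simp only [h1, h2]
    exact (summable_fderiv_kernelTerm hc0 hc1 _).hasSum.mapL
      (ContinuousLinearMap.apply ℂ ℂ ((toComplex v, 0) : ComplexSpace N × ComplexSpace N))
  have hs : ∀ x : RealSpace N, HasSum (fun n => kernelTerm c n (toComplex x, toComplex y))
      (∑' n, kernelTerm c n (toComplex x, toComplex y)) := fun x =>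
    (summable_kernelTerm hc0 hc1 _).hasSum
  refine (hd ξ).add (HasSum.mul_left _ (hasSum_sum fun α _ => HasSum.mul_left _ ?_))
  unfold reflectionQuotient
  split_ifs
  · exact (hd _).mul_left _
  · exact ((hs x).sub (hs _)).div_const _

end Terms

theorem exists_isDunklKernel {N : ℕ} {R : Finset (RealSpace N)} (hR : IsRootSystem R)
    {μ : R → ℝ} (hμ : IsMultiplicityFunction R μ) (hμ0 : ∀ α, 0 ≤ μ α) :
    ∃ E, IsDunklKernel μ E := by
  classical
  have := hR.finite_coxeterGroup
  have := Fintype.ofFinite (coxeterGroup R)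
  have hex : ∀ n : ℕ, ∃ c : coxeterGroup R → ℝ, (∀ g, 0 ≤ c g) ∧
      (∑ g, c g = (∑ g, if g = (1 : coxeterGroup R) then (1 : ℝ) else 0) / ((n + 1 : ℕ) : ℝ)) ∧
      ∀ g, ((n + 1 : ℕ) : ℝ) * c g + ∑ α : R, μ α / 2 * (c g - c (g * groupReflection α)) =
        if g = 1 then 1 else 0 := fun n =>
    -- The source is the indicator of the identity, of mass `1`, so the weights have mass `1/(n+1)`.
    exists_nonneg_mul_add_sum_sub_eq (fun α : R => Equiv.mulRight (groupReflection α))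
      (fun α => div_nonneg (hμ0 α) zero_le_two) (by positivity) _
      (fun g => by split_ifs <;> norm_num)
  choose c hc0 hc1 hc using hex
  simp only [Finset.sum_ite_eq', Finset.mem_univ, if_true] at hc1
  refine ⟨fun z w => ∑' n, kernelTerm c n (z, w), ?_, ?_, ?_, ?_⟩
  · exact fun p => (hasFDerivAt_tsum_kernelTerm hc0 hc1 p).differentiableAt
  · intro x y
    rw [Complex.im_tsum (summable_kernelTerm hc0 hc1 _)]
    simp only [im_kernelTerm, tsum_zero]
  · intro ξ x y
    refine (hasSum_dunklOperator_kernelTerm hc0 hc1 ξ x y).unique ?_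
    have h := ((summable_kernelTerm hc0 hc1 (toComplex x, toComplex y)).hasSum.mul_left
      ((inner ℝ ξ y : ℝ) : ℂ))
    simp only [← dunklOperator_kernelTerm hR hμ hμ0 hc] at h
    -- The eigenvalue relation lowers the index by one; the missing initial term is a Dunkl operator
    -- applied to a constant, hence zero.
    have h' := h.zero_add (f := fun n =>
      dunklOperator μ ξ (fun x => kernelTerm c n (toComplex x, toComplex y)) x)
    simpa only [kernelTerm, dunklOperator_const, zero_add] using h'
  · intro y
    have h : ∀ n, n ≠ 0 → kernelTerm c n (0, toComplex y) = 0 := fun n hn => by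
      have := kernelTerm_smul c n 0 0 (toComplex y)
      rwa [zero_smul, zero_pow hn, zero_mul] at this
    refine (tsum_eq_single 0 h).trans ?_
    simp [kernelTerm]

theorem isDunklKernel_dunklKernel {N : ℕ} {R : Finset (RealSpace N)} (hR : IsRootSystem R)
    {μ : R → ℝ} (hμ : IsMultiplicityFunction R μ) (hμ0 : ∀ α, 0 ≤ μ α) :
    IsDunklKernel μ (dunklKernel μ) :=
  Classical.epsilon_spec (exists_isDunklKernel hR hμ hμ0)

/-! ### The heat kernel -/

section HeatKernel

variable {N : ℕ} {R : Finset (RealSpace N)} {μ : R → ℝ} {t : ℝ}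

theorem isHolomorphicContinuation_heatKernel (hE : IsDunklKernel μ (dunklKernel μ)) :
    IsHolomorphicContinuation (heatKernel μ t) fun z w =>
      Complex.exp (-(bilinSq z + bilinSq w) / (2 * (t : ℂ))) *
        dunklKernel μ ((((Real.sqrt t)⁻¹ : ℝ) : ℂ) • z) ((((Real.sqrt t)⁻¹ : ℝ) : ℂ) • w) := by
  constructor
  · have hsq : Differentiable ℂ (bilinSq : ComplexSpace N → ℂ) :=
      (contDiff_bilinSq (n := 1)).differentiable one_ne_zero
    have h1 : Differentiable ℂ fun p : ComplexSpace N × ComplexSpace N =>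
        -(bilinSq p.1 + bilinSq p.2) / (2 * (t : ℂ)) := by fun_prop
    have h2 : Differentiable ℂ fun p : ComplexSpace N × ComplexSpace N =>
        ((((Real.sqrt t)⁻¹ : ℝ) : ℂ) • p.1, (((Real.sqrt t)⁻¹ : ℝ) : ℂ) • p.2) := by fun_prop
    exact h1.cexp.mul (hE.holomorphic.comp h2)
  · intro x y
    rw [heatKernel, ← toComplex_smul, ← toComplex_smul, bilinSq_toComplex, bilinSq_toComplex,
      Complex.ofReal_mul, Complex.ofReal_exp]
    congr 1
    · push_cast
      rfl
    · exact Complex.ext rfl (hE.real_valued _ _)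

/-- The choice made in `heatKernelC` is immaterial: the explicit formula is one continuation, and
continuations agree because they agree at real points. -/
theorem heatKernelC_eq (hE : IsDunklKernel μ (dunklKernel μ)) (z w : ComplexSpace N) :
    heatKernelC μ t z w = Complex.exp (-(bilinSq z + bilinSq w) / (2 * (t : ℂ))) *
      dunklKernel μ ((((Real.sqrt t)⁻¹ : ℝ) : ℂ) • z) ((((Real.sqrt t)⁻¹ : ℝ) : ℂ) • w) := by
  have h1 := isHolomorphicContinuation_heatKernel (t := t) hE
  have h2 : IsHolomorphicContinuation (heatKernel μ t) (heatKernelC μ t) :=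
    Classical.epsilon_spec ⟨_, h1⟩
  exact congrFun (congrFun (eq_of_eq_on_real h2.holomorphic h1.holomorphic fun x y =>
    (h2.extends_real x y).trans (h1.extends_real x y).symm) z) w

theorem heatKernel_zero_left (hE : IsDunklKernel μ (dunklKernel μ)) (q : RealSpace N) :
    heatKernel μ t 0 q = Real.exp (-‖q‖ ^ 2 / (2 * t)) := by
  simp [heatKernel, hE.map_zero]

theorem versionAKernel_eq (hE : IsDunklKernel μ (dunklKernel μ)) (z : ComplexSpace N)
    (q : RealSpace N) : versionAKernel μ t z q = heatKernelC μ t z (toComplex q) /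
      ((Real.sqrt (heatKernel μ t 0 q) : ℝ) : ℂ) := by
  -- The square root halves the Gaussian exponent, and `-‖q‖²/2t + ‖q‖²/4t = -‖q‖²/4t`.
  rw [heatKernelC_eq hE, heatKernel_zero_left hE, ← Real.exp_half, Complex.ofReal_exp,
    mul_div_right_comm, ← Complex.exp_sub, versionAKernel, toComplex_smul, bilinSq_toComplex]
  congr 2
  push_cast
  ring

end HeatKernel

end Dunkl

end

theorem mainTheorem4 {N : ℕ} (R : Finset (Dunkl.RealSpace N)) (hR : Dunkl.IsRootSystem R)
    (μ : R → ℝ) (hμ : Dunkl.IsMultiplicityFunction R μ) (hμ_nonneg : ∀ α, 0 ≤ μ α)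
    (t : ℝ) (ht : 0 < t) :
    Dunkl.IsDunklKernel μ (Dunkl.dunklKernel μ) ∧
    Dunkl.IsHolomorphicContinuation (Dunkl.heatKernel μ t) (Dunkl.heatKernelC μ t) ∧
    (∀ q : Dunkl.RealSpace N, 0 < Dunkl.heatKernel μ t 0 q) ∧
    ∀ (z : Dunkl.ComplexSpace N) (q : Dunkl.RealSpace N),
      Dunkl.versionAKernel μ t z q =
        Dunkl.heatKernelC μ t z (Dunkl.toComplex q) /
          ((Real.sqrt (Dunkl.heatKernel μ t 0 q) : ℝ) : ℂ) := by
  have hE := Dunkl.isDunklKernel_dunklKernel hR hμ hμ_nonneg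
  refine ⟨hE, Classical.epsilon_spec ⟨_, Dunkl.isHolomorphicContinuation_heatKernel hE⟩,
    fun q => ?_, Dunkl.versionAKernel_eq hE⟩
  rw [Dunkl.heatKernel_zero_left hE]
  exact Real.exp_pos _
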